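/- **Setting.** Let $d,n\ge 1$, $\lambda^0\in\mathbb R^d$, and for every $\lambda\in\mathbb R^d$ let $Z(\lambda)$ be a random vector of $\mathbb R^n$ with Lebesgue density $f(\lambda,\cdot)\ge 0$; write $Z^0=Z(\lambda^0)$. Let $\phi:\mathbb R^n\to\mathbb R$ be in $L^\infty$, put $V^\phi(\lambda)=E[\phi(Z(\lambda))]$ and $\beta=\nabla V^\phi(\lambda^0)$. Let $\ell$ be a probability density on $\mathbb R^d$ with $\ell(0)>0$, and let $(\Lambda_i,Z_i)_{i\ge1}$ be i.i.d. with density $\ell(\lambda^0-\lambda)f(\lambda,z)$ on $\mathbb R^d\times\mathbb R^n$. For a kernel $K:\mathbb R^d\to\mathbb R$ and a bandwidth $h=h_N>0$ let $$\hat\beta_N=\frac1{\ell(0)Nh^{d+1}}\sum_{i=1}^N\phi(Z_i)\Big(\nabla K\big(\tfrac{\lambda^0-\Lambda_i}h\big)+hK\big(\tfrac{\lambda^0-\Lambda_i}h\big)\frac{\nabla\ell}{\ell}(\lambda^0-\Lambda_i)\Big).$$ **Assumption K.** $K$ is $C^1$, compactly supported, $\int K=1$, and $K$ is of order $p\ge2$: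 $\int l_{\alpha_1}\cdots l_{\alpha_r}K(l)\,dl=0$ for all $0<r<p$ and all indices $\alpha_k\in\{1,\dots,d\}$, while $\int l_{j_1}\cdots l_{j_p}K(l)\,dl\ne0$ for some $j_1,\dots,j_p$. **Assumption R1.** $\ell$ and, for every $z$, $f(\cdot,z)$ are $p+1$ times differentiable on $\mathbb R^d$; and with $g(\lambda,z)=\ell(\lambda^0-\lambda)\nabla_\lambda f(\lambda,z)$ there is a set $S\subset\mathbb R^n$ with $\mathrm{Supp}(\phi)\subset\mathrm{int}(S)$ such that for every $i\le p$ the function $\lambda\mapsto\nabla^i_\lambda g(\lambda,z)$ is continuous at $\lambda^0$ uniformly in $z\in S$. **Theorem 4.1.** Assume K and R1, and let $h\to0$ and $Nh^{d+2}\to\infty$ as $N\to\infty$. Put $$\Sigma=\frac{E[\phi^2(Z^0)]}{\ell(0)}\int_{\mathbb R^d}\nabla K(l)\,\nabla K(l)'\,dl .$$ (i) Each $\hat\beta_N$ is integrable and $\sqrt{Nh^{d+2}}\,(\hat\beta_N-E[\hat\beta_N])\to\mathcal N(0,\Sigma)$ in distribution. (ii) Assume in addition that $Nh^{d+2+2p}\to0$,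 and that for some Lebesgue integrable $G$ and some $\delta>0$, $$|\phi(z)|\,\|\nabla^i_\lambda g(\lambda,z)-\nabla^i_\lambda g(\lambda^0,z)\|\le G(z)\qquad\text{for all } i\le p,\ |\lambda-\lambda^0|<\delta,\ z\in\mathbb R^n$$ (under R1 this holds automatically, with $G=|\phi|$, if $\phi$ is Lebesgue integrable, for instance if $\phi$ has bounded support). Then $V^\phi$ is differentiable at $\lambda^0$; the bias vanishes, that is, $E[\hat\beta_N]-\beta\to0$ and $\sqrt{Nh^{d+2}}\,(E[\hat\beta_N]-\beta)\to0$; and $\sqrt{Nh^{d+2}}\,(\hat\beta_N-\beta)\to\mathcal N(0,\Sigma)$ in distribution. -/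

import Mathlib

open MeasureTheory ProbabilityTheory Filter Topology

noncomputable section

namespace KernelGreeks

/-- `u` is `k` times (Fréchet) differentiable on the whole space: the iterated derivatives of
orders `0, …, k - 1` are differentiable. The derivative of order `k` need not be continuous. -/
def DifferentiableTimes {d : ℕ} (k : ℕ) (u : EuclideanSpace ℝ (Fin d) → ℝ) : Prop :=
  ∀ m < k, Differentiable ℝ (iteratedFDeriv ℝ m u)

/-- The moment `∫ l_{j_1} ⋯ l_{j_r} K(l) dl` of a kernel. -/
def kernelMoment {d : ℕ} (K : EuclideanSpace ℝ (Fin d) → ℝ) {r : ℕ} (j : Fin r → Fin d) : ℝ :=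
  ∫ l, (∏ k, l (j k)) * K l

/-- `K` is of order `p`: `p` is the smallest nonzero integer for which some moment of degree `p`
does not vanish. -/
def HasKernelOrder {d : ℕ} (K : EuclideanSpace ℝ (Fin d) → ℝ) (p : ℕ) : Prop :=
  0 < p ∧ (∀ r, 0 < r → r < p → ∀ α : Fin r → Fin d, kernelMoment K α = 0) ∧
    ∃ j : Fin p → Fin d, kernelMoment K j ≠ 0

/-- The assumption on the kernel: `C^1`, compactly supported, of integral one and of order
`p ≥ 2`. -/
structure AssumptionK {d : ℕ} (K : EuclideanSpace ℝ (Fin d) → ℝ) (p : ℕ) : Prop where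
  contDiff : ContDiff ℝ 1 K
  compact : HasCompactSupport K
  integral_eq_one : ∫ l, K l = 1
  two_le : 2 ≤ p
  order : HasKernelOrder K p

/-- The function `x ↦ ℓ(x₀ - x) ∇ₓ f(x, z)`. -/
def weightedGradient {d n : ℕ} (x₀ : EuclideanSpace ℝ (Fin d)) (ℓ : EuclideanSpace ℝ (Fin d) → ℝ)
    (f : EuclideanSpace ℝ (Fin d) → EuclideanSpace ℝ (Fin n) → ℝ) (z : EuclideanSpace ℝ (Fin n))
    (x : EuclideanSpace ℝ (Fin d)) : EuclideanSpace ℝ (Fin d) :=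
  ℓ (x₀ - x) • gradient (fun y => f y z) x

/-- The regularity assumption on the densities: `f(·, z)` and `ℓ` are `p + 1` times differentiable,
and the derivatives of orders `i ≤ p` of `x ↦ ℓ(x₀ - x) ∇ₓ f(x, z)` are continuous at `x₀`,
uniformly in `z ∈ S`, for some set `S` whose interior contains the support of `φ`. -/
structure AssumptionR1 {d n : ℕ} (p : ℕ) (x₀ : EuclideanSpace ℝ (Fin d))
    (ℓ : EuclideanSpace ℝ (Fin d) → ℝ)
    (f : EuclideanSpace ℝ (Fin d) → EuclideanSpace ℝ (Fin n) → ℝ)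
    (φ : EuclideanSpace ℝ (Fin n) → ℝ) : Prop where
  differentiable_f : ∀ z, DifferentiableTimes (p + 1) (fun x => f x z)
  differentiable_ℓ : DifferentiableTimes (p + 1) ℓ
  uniform_continuity : ∃ S : Set (EuclideanSpace ℝ (Fin n)), tsupport φ ⊆ interior S ∧
    ∀ i ≤ p, ∀ ε > 0, ∃ δ > 0, ∀ x ∈ Metric.ball x₀ δ, ∀ z ∈ S,
      ‖iteratedFDeriv ℝ i (weightedGradient x₀ ℓ f z) x -
        iteratedFDeriv ℝ i (weightedGradient x₀ ℓ f z) x₀‖ ≤ ε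

/-- The oscillation near `x₀` of the derivatives of orders `i ≤ p` of `x ↦ ℓ(x₀ - x) ∇ₓ f(x, z)`,
multiplied by `|φ(z)|`, is dominated by a Lebesgue integrable function of `z`. Under the
regularity assumption above this is automatic when `φ` is Lebesgue integrable. -/
def DominatedOscillation {d n : ℕ} (p : ℕ) (x₀ : EuclideanSpace ℝ (Fin d))
    (ℓ : EuclideanSpace ℝ (Fin d) → ℝ)
    (f : EuclideanSpace ℝ (Fin d) → EuclideanSpace ℝ (Fin n) → ℝ)
    (φ : EuclideanSpace ℝ (Fin n) → ℝ) : Prop :=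
  ∃ G : EuclideanSpace ℝ (Fin n) → ℝ, Integrable G ∧
    ∃ δ > 0, ∀ i ≤ p, ∀ x ∈ Metric.ball x₀ δ, ∀ z,
      |φ z| * ‖iteratedFDeriv ℝ i (weightedGradient x₀ ℓ f z) x -
        iteratedFDeriv ℝ i (weightedGradient x₀ ℓ f z) x₀‖ ≤ G z

/-- The joint law of `(Λ, Z)`, with density `(x, z) ↦ ℓ(x₀ - x) f(x, z)`. -/
def randomizedLaw {d n : ℕ} (x₀ : EuclideanSpace ℝ (Fin d)) (ℓ : EuclideanSpace ℝ (Fin d) → ℝ)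
    (f : EuclideanSpace ℝ (Fin d) → EuclideanSpace ℝ (Fin n) → ℝ) :
    Measure (EuclideanSpace ℝ (Fin d) × EuclideanSpace ℝ (Fin n)) :=
  volume.withDensity fun q => ENNReal.ofReal (ℓ (x₀ - q.1) * f q.1 q.2)

/-- The single-kernel estimator `β̂_N` with bandwidth `h`, computed from the first `N` terms of
the sample `(x i, z i)`:
`(ℓ(0) N h^{d+1})⁻¹ ∑_{i<N} φ(z_i) (∇K((x₀-x_i)/h) + h K((x₀-x_i)/h) (∇ℓ/ℓ)(x₀-x_i))`. -/
def betaHat {d n : ℕ} (K ℓ : EuclideanSpace ℝ (Fin d) → ℝ) (φ : EuclideanSpace ℝ (Fin n) → ℝ)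
    (x₀ : EuclideanSpace ℝ (Fin d)) (N : ℕ) (h : ℝ)
    (x : ℕ → EuclideanSpace ℝ (Fin d)) (z : ℕ → EuclideanSpace ℝ (Fin n)) :
    EuclideanSpace ℝ (Fin d) :=
  (1 / (ℓ 0 * N * h ^ (d + 1))) • ∑ i ∈ Finset.range N,
    φ (z i) • (gradient K (h⁻¹ • (x₀ - x i)) +
      (h * K (h⁻¹ • (x₀ - x i))) • ((ℓ (x₀ - x i))⁻¹ • gradient ℓ (x₀ - x i)))

/-- The asymptotic covariance `Σ = (m / ℓ(0)) ∫ ∇K ∇Kᵀ`, where `m` stands for `E[φ²(Z⁰)]`. -/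
def asymptoticCov {d : ℕ} (K ℓ : EuclideanSpace ℝ (Fin d) → ℝ) (m : ℝ) :
    Matrix (Fin d) (Fin d) ℝ :=
  (m / ℓ 0) • Matrix.of fun i j => ∫ l, gradient K l i * gradient K l j

end KernelGreeks

end

/-! Up to a scalar, the estimator is a sum of `N` i.i.d. copies of `summand`. The change of
variables `l = (x₀ - x) / h` turns the moments of a summand into `h ^ d` times integrals over the
compact support of `K` (`integral_inner_summand_pow`). As `h → 0` the score tends to `∇K`, and `x ↦
E[φ(Z x) ^ k]` is continuous for bounded `φ`, because a pointwise continuous family of probability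
densities is continuous in `L¹` (Scheffé). Hence the second moment in a direction `t` is
asymptotically `h ^ d ℓ(0) E[φ²(Z⁰)] ∫ ⟪∇K, t⟫²`, while the squared mean is `O(h ^ (2d))` and
negligible. For small `h` the summands are bounded by a constant and their normalization tends to
zero, so the array is uniformly small and an expansion of characteristic functions gives the
Gaussian limit (`tendstoInDistribution_sum_of_small`).

For the bias, an integration by parts at fixed `z` moves the gradient from `K` to `ℓ f`. The
correction `∇ℓ / ℓ` cancels the derivative of `ℓ`, and the mean becomes `ℓ(0)⁻¹ ∫ φ(z) ∫ K(l) g(x₀ -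
h l, z) dl dz` with `g` the weighted gradient. A kernel of order `p` kills the Taylor terms of
degrees `0 < i < p`, so the error is governed by the derivative of order `p` of `g`
(`AssumptionK.norm_integral_smul_sub_le`). Integrating it in `z` requires an integrable bound of
that derivative itself, whereas the assumption only dominates oscillations. Two observations fill
the gap (`exists_integrable_bound`): the oscillations of two successive derivatives control the
higher one, and the increments of `f`, which are integrable, control `∇f` at `x₀`. The latter bound
also allows differentiation under the integral, which identifies the limit of the mean with `β`. The
bias is thus `O(h ^ p)`, and Slutsky's lemma recenters the limit theorem. -/

noncomputable section

namespace KernelGreeks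

open scoped InnerProductSpace Matrix

/-! ### Central limit theorem for triangular arrays -/

/-- Second order expansion of the characteristic function of a small centered random variable. -/
lemma norm_integral_exp_mul_I_sub_le {Ω : Type*} [MeasurableSpace Ω] {P : Measure Ω}
    [IsProbabilityMeasure P] {W : Ω → ℝ} (hW : AEMeasurable W P) (h0 : ∫ ω, W ω ∂P = 0)
    {ε : ℝ} (hε : ε ≤ 1) (hb : ∀ᵐ ω ∂P, |W ω| ≤ ε) :
    ‖∫ ω, Complex.exp (W ω * Complex.I) ∂P - (1 - (∫ ω, W ω ^ 2 ∂P : ℝ) / 2)‖ ≤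
      3 * ε * ∫ ω, W ω ^ 2 ∂P := by
  have hWs : AEStronglyMeasurable W P := hW.aestronglyMeasurable
  have hi1 : Integrable W P := Integrable.of_bound hWs ε (by simpa using hb)
  have hi2 : Integrable (fun ω => W ω ^ 2) P := by
    refine Integrable.of_bound (hWs.pow 2) (ε ^ 2) ?_
    filter_upwards [hb] with ω hω
    simpa [abs_pow] using pow_le_pow_left₀ (abs_nonneg _) hω 2
  have hie : Integrable (fun ω => Complex.exp (W ω * Complex.I)) P := by
    refine Integrable.of_bound ?_ 1 (ae_of_all _ fun ω => by simp [Complex.norm_exp_ofReal_mul_I])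
    exact (by fun_prop : Continuous fun x : ℝ => Complex.exp (x * Complex.I)).comp_aestronglyMeasurable
      hWs
  have hiq : Integrable (fun ω => (1 : ℂ) + (W ω : ℂ) * Complex.I - ((W ω ^ 2 : ℝ) : ℂ) / 2) P :=
    ((integrable_const _).add (hi1.ofReal.mul_const _)).sub (hi2.ofReal.div_const _)
  have heq : ∫ ω, ((1 : ℂ) + (W ω : ℂ) * Complex.I - ((W ω ^ 2 : ℝ) : ℂ) / 2) ∂P
      = 1 - (∫ ω, W ω ^ 2 ∂P : ℝ) / 2 := by
    rw [integral_sub ((integrable_const _).add (hi1.ofReal.mul_const _)) (hi2.ofReal.div_const _),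
      integral_add (integrable_const _) (hi1.ofReal.mul_const _), integral_mul_const,
      integral_div, integral_complex_ofReal, integral_complex_ofReal, h0]
    simp
  rw [← heq, ← integral_sub hie hiq, ← integral_const_mul]
  refine norm_integral_le_of_norm_le (hi2.const_mul _) ?_
  filter_upwards [hb] with ω hω
  have h := Complex.norm_exp_sub_sum_le_norm_mul_exp (W ω * Complex.I) 3
  have hn : ‖(W ω : ℂ) * Complex.I‖ = |W ω| := by simp
  rw [hn] at h
  have hs : ∑ m ∈ Finset.range 3, ((W ω : ℂ) * Complex.I) ^ m / (m.factorial : ℂ)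
      = (1 : ℂ) + (W ω : ℂ) * Complex.I - ((W ω ^ 2 : ℝ) : ℂ) / 2 := by
    simp [Finset.sum_range_succ, mul_pow]
    ring
  rw [hs] at h
  refine h.trans ?_
  -- The constant 3 of the statement is a bound of `e`, since `|W| ≤ ε ≤ 1`.
  have he : Real.exp |W ω| ≤ 3 :=
    (Real.exp_le_exp.2 (hω.trans hε)).trans Real.exp_one_lt_three.le
  calc |W ω| ^ 3 * Real.exp |W ω| = |W ω| * W ω ^ 2 * Real.exp |W ω| := by
        rw [← sq_abs]; ring
    _ ≤ ε * W ω ^ 2 * 3 := by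
        gcongr
        exact mul_nonneg ((abs_nonneg _).trans hω) (sq_nonneg _)
    _ = _ := by ring

/-- **Central limit theorem** for row-wise i.i.d. triangular arrays of uniformly small centered
random vectors. -/
theorem tendstoInDistribution_sum_of_small {d : ℕ} {Ω : Type*} [MeasurableSpace Ω] {P : Measure Ω}
    [IsProbabilityMeasure P] {X : ℕ → ℕ → Ω → EuclideanSpace ℝ (Fin d)}
    (hX : ∀ N i, AEMeasurable (X N i) P) (hindep : ∀ N, iIndepFun (X N) P)
    (hident : ∀ N i, P.map (X N i) = P.map (X N 0))
    (h0 : ∀ᶠ N in atTop, ∫ ω, X N 0 ω ∂P = 0) {ε : ℕ → ℝ} (hε : Tendsto ε atTop (𝓝 0))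
    (hb : ∀ᶠ N in atTop, ∀ᵐ ω ∂P, ‖X N 0 ω‖ ≤ ε N)
    {S : Matrix (Fin d) (Fin d) ℝ} (hS : S.PosSemidef)
    (hv : ∀ t, Tendsto (fun N : ℕ => N * ∫ ω, ⟪X N 0 ω, t⟫_ℝ ^ 2 ∂P) atTop
      (𝓝 (t ⬝ᵥ S *ᵥ t))) :
    TendstoInDistribution (fun N ω => ∑ i ∈ Finset.range N, X N i ω) atTop id
      (fun _ => P) (multivariateGaussian 0 S) where
  forall_aemeasurable N := Finset.aemeasurable_fun_sum _ fun i _ => hX N i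
  tendsto := by
    refine ProbabilityMeasure.tendsto_iff_tendsto_charFun.2 fun t => ?_
    have hcf (N : ℕ) : charFun (P.map fun ω => ∑ i ∈ Finset.range N, X N i ω) t
        = (∫ ω, Complex.exp ((⟪X N 0 ω, t⟫_ℝ : ℝ) * Complex.I) ∂P) ^ N := by
      rw [((hindep N).restrict _).charFun_map_fun_finsetSum_eq_prod fun i _ => hX N i]
      simp only [hident N, Finset.prod_const, Finset.card_range, Pi.pow_apply]
      rw [charFun_apply, integral_map (hX N 0)]
      exact (by fun_prop : Continuous fun x : EuclideanSpace ℝ (Fin d) =>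
        Complex.exp ((⟪x, t⟫_ℝ : ℝ) * Complex.I)).aestronglyMeasurable
    simp only [ProbabilityMeasure.coe_mk, Measure.map_id, hcf]
    rw [charFun_multivariateGaussian hS]
    simp only [inner_zero_right, Complex.ofReal_zero, zero_mul, zero_sub]
    set s : ℝ := t ⬝ᵥ S *ᵥ t with hs
    -- With `c = E[exp(i⟪X, t⟫)] - 1`, it suffices that `N c → -s / 2`. The variance term gives this
    -- limit, and the remainder is at most `ε N * ‖t‖` times a convergent sequence.
    have hgoal : Tendsto (fun N : ℕ => (1 + (∫ ω, Complex.exp ((⟪X N 0 ω, t⟫_ℝ : ℝ) * Complex.I) ∂P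
        - 1)) ^ N) atTop (𝓝 (Complex.exp (-(s / 2 : ℂ)))) := by
      refine Complex.tendsto_one_add_pow_exp_of_tendsto ?_
      have h1 : Tendsto (fun N : ℕ => -((N * ∫ ω, ⟪X N 0 ω, t⟫_ℝ ^ 2 ∂P : ℝ) / 2 : ℂ)) atTop
          (𝓝 (-(s / 2 : ℂ))) :=
        (((Complex.continuous_ofReal.tendsto _).comp (hv t)).div_const _).neg
      have h2 : Tendsto (fun N : ℕ => (N : ℂ) * (∫ ω, Complex.exp ((⟪X N 0 ω, t⟫_ℝ : ℝ) * Complex.I) ∂P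
          - (1 - (∫ ω, ⟪X N 0 ω, t⟫_ℝ ^ 2 ∂P : ℝ) / 2))) atTop (𝓝 0) := by
        have h3 : Tendsto (fun N : ℕ => 3 * (ε N * ‖t‖) * (N * ∫ ω, ⟪X N 0 ω, t⟫_ℝ ^ 2 ∂P)) atTop
            (𝓝 0) := by
          simpa using ((hε.mul_const ‖t‖).const_mul 3).mul (hv t)
        refine squeeze_zero_norm' ?_ h3
        have hsmall : ∀ᶠ N in atTop, ε N * ‖t‖ ≤ 1 := by
          have : Tendsto (fun N => ε N * ‖t‖) atTop (𝓝 0) := by simpa using hε.mul_const ‖t‖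
          exact this.eventually_le_const one_pos
        filter_upwards [h0, hb, hsmall] with N hN0 hNb hNs
        have hint : Integrable (X N 0) P :=
          Integrable.of_bound (hX N 0).aestronglyMeasurable _ hNb
        have := norm_integral_exp_mul_I_sub_le (P := P) (W := fun ω => ⟪X N 0 ω, t⟫_ℝ)
          ((by fun_prop : Measurable fun x : EuclideanSpace ℝ (Fin d) => ⟪x, t⟫_ℝ).comp_aemeasurable
            (hX N 0)) (by
            simp only [real_inner_comm t]
            rw [integral_inner hint t, hN0, inner_zero_right]) hNs (by
            filter_upwards [hNb] with ω hω
            exact (abs_real_inner_le_norm _ _).trans (by gcongr))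
        rw [norm_mul, Complex.norm_natCast]
        calc _ ≤ (N : ℝ) * (3 * (ε N * ‖t‖) * ∫ ω, ⟪X N 0 ω, t⟫_ℝ ^ 2 ∂P) := by gcongr
          _ = _ := by ring
      have h4 := h1.add h2
      rw [add_zero] at h4
      refine h4.congr fun N => ?_
      push_cast
      ring
    simpa [hs] using hgoal

/-! ### Repeated differentiability and Taylor's formula -/

/-- The iterated derivatives of orders `0, …, k - 1` are differentiable. -/
def IterDiff {E F : Type} [NormedAddCommGroup E] [NormedSpace ℝ E] [NormedAddCommGroup F]
    [NormedSpace ℝ F] (k : ℕ) (u : E → F) : Prop :=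
  ∀ m < k, Differentiable ℝ (iteratedFDeriv ℝ m u)

section IterDiff

variable {E F G W : Type} [NormedAddCommGroup E] [NormedSpace ℝ E] [NormedAddCommGroup F]
  [NormedSpace ℝ F] [NormedAddCommGroup G] [NormedSpace ℝ G] [NormedAddCommGroup W]
  [NormedSpace ℝ W] {k : ℕ}

lemma IterDiff.mono {j : ℕ} {u : E → F} (h : IterDiff k u) (hj : j ≤ k) : IterDiff j u :=
  fun m hm => h m (hm.trans_le hj)

lemma iterDiff_zero (u : E → F) : IterDiff 0 u := fun _ hm => absurd hm (Nat.not_lt_zero _)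

/-- Peeling off the innermost derivative makes every closure property below an induction on `k`, in
which the codomain changes from `F` to `E →L[ℝ] F`. -/
lemma iterDiff_succ_iff {u : E → F} :
    IterDiff (k + 1) u ↔ Differentiable ℝ u ∧ IterDiff k (fderiv ℝ u) := by
  have h0 : Differentiable ℝ (iteratedFDeriv ℝ 0 u) ↔ Differentiable ℝ u := by
    rw [iteratedFDeriv_zero_eq_comp]
    exact (continuousMultilinearCurryFin0 ℝ E F).symm.comp_differentiable_iff
  have hs (m : ℕ) : Differentiable ℝ (iteratedFDeriv ℝ (m + 1) u) ↔
      Differentiable ℝ (iteratedFDeriv ℝ m (fderiv ℝ u)) := by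
    rw [show iteratedFDeriv ℝ (m + 1) u = _ from
      funext fun x => iteratedFDeriv_succ_eq_comp_right (f := u) (x := x)]
    exact LinearIsometryEquiv.comp_differentiable_iff (𝕜 := ℝ) (G := E) (E := E [×m]→L[ℝ] E →L[ℝ] F)
      (F := E [×(m + 1)]→L[ℝ] F) (iso := (continuousMultilinearCurryRightEquiv' ℝ m E F).symm)
  constructor
  · intro h
    exact ⟨h0.1 (h 0 (Nat.succ_pos _)), fun m hm => (hs m).1 (h _ (Nat.succ_lt_succ hm))⟩
  · rintro ⟨h1, h2⟩ (_ | m) hm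
    · exact h0.2 h1
    · exact (hs m).2 (h2 m (Nat.lt_of_succ_lt_succ hm))

/-- One order is lost: differentiability of the derivative of order `k` yields its continuity, and
nothing about the continuity of the next one. -/
lemma IterDiff.contDiff {u : E → F} (h : IterDiff (k + 1) u) : ContDiff ℝ k u :=
  contDiff_of_differentiable_iteratedFDeriv fun m hm => h m (by
    have : m ≤ k := by exact_mod_cast hm
    omega)

lemma IterDiff.add {u v : E → F} (hu : IterDiff k u) (hv : IterDiff k v) :
    IterDiff k (fun x => u x + v x) := by
  induction k generalizing F with
  | zero => exact iterDiff_zero _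
  | succ k ih =>
    rw [iterDiff_succ_iff] at *
    refine ⟨hu.1.add hv.1, ?_⟩
    have : fderiv ℝ (fun x => u x + v x) = fun x => fderiv ℝ u x + fderiv ℝ v x :=
      funext fun x => fderiv_fun_add (hu.1 x) (hv.1 x)
    rw [this]
    exact ih hu.2 hv.2

lemma IterDiff.clm_comp {u : E → F} (hu : IterDiff k u) (L : F →L[ℝ] G) :
    IterDiff k (fun x => L (u x)) := by
  induction k generalizing F G with
  | zero => exact iterDiff_zero _
  | succ k ih =>
    rw [iterDiff_succ_iff] at *
    refine ⟨L.differentiable.comp hu.1, ?_⟩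
    have : fderiv ℝ (fun x => L (u x)) =
        fun x => ContinuousLinearMap.compL ℝ E F G L (fderiv ℝ u x) :=
      funext fun x => (L.hasFDerivAt.comp x (hu.1 x).hasFDerivAt).fderiv
    rw [this]
    exact ih hu.2 _

/-- By the Leibniz rule the derivative is a sum of two expressions of the same kind, for the
bilinear maps `B.precompR E` and `B.precompL E`, so the induction closes once it is stated for all
bilinear maps. -/
lemma IterDiff.bilinear {u : E → F} {v : E → G} (hu : IterDiff k u) (hv : IterDiff k v)
    (B : F →L[ℝ] G →L[ℝ] W) : IterDiff k (fun x => B (u x) (v x)) := by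
  induction k generalizing F G W with
  | zero => exact iterDiff_zero _
  | succ k ih =>
    have hu' := hu.mono k.le_succ
    have hv' := hv.mono k.le_succ
    rw [iterDiff_succ_iff] at *
    have hd (x : E) := B.hasFDerivAt_of_bilinear (hu.1 x).hasFDerivAt (hv.1 x).hasFDerivAt
    refine ⟨fun x => (hd x).differentiableAt, ?_⟩
    rw [show fderiv ℝ (fun x => B (u x) (v x)) = _ from funext fun x => (hd x).fderiv]
    exact (ih hu' hv.2 (B.precompR E)).add (ih hu.2 hv' (B.precompL E))

lemma IterDiff.comp_const_sub {u : E → F} (hu : IterDiff k u) (a : E) :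
    IterDiff k (fun x => u (a - x)) := by
  induction k generalizing F with
  | zero => exact iterDiff_zero _
  | succ k ih =>
    rw [iterDiff_succ_iff] at *
    refine ⟨hu.1.comp (differentiable_const a |>.sub differentiable_id), ?_⟩
    have : fderiv ℝ (fun x => u (a - x)) =
        fun x => (-ContinuousLinearMap.id ℝ (E →L[ℝ] F)) (fderiv ℝ u (a - x)) := by
      funext x
      refine ((hu.1 (a - x)).hasFDerivAt.comp x ((hasFDerivAt_id x).const_sub a)).fderiv.trans ?_
      ext v
      simp
    rw [this]
    exact (ih hu.2).clm_comp _

/-- The values along a line of the iterated derivatives of a function. -/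
lemma IterDiff.hasDerivAt_line {g : E → F} (hg : IterDiff k g) {i : ℕ} (hi : i < k) (x v : E)
    (t : ℝ) : HasDerivAt (fun s : ℝ => iteratedFDeriv ℝ i g (x + s • v) (fun _ => v))
      (iteratedFDeriv ℝ (i + 1) g (x + t • v) (fun _ => v)) t := by
  have hl : HasDerivAt (fun s : ℝ => x + s • v) v t := by
    simpa using ((hasDerivAt_id t).smul_const v).const_add x
  have h1 := ((hg i hi (x + t • v)).hasFDerivAt.comp_hasDerivAt t hl)
  have h2 := (ContinuousMultilinearMap.apply ℝ (fun _ : Fin i => E) F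
    (fun _ => v)).hasFDerivAt.comp_hasDerivAt t h1
  rw [iteratedFDeriv_succ_apply_left]
  exact h2

end IterDiff

/-- Taylor's formula on `[0, 1]`, with a bound of the last derivative as remainder. -/
lemma norm_sub_taylor_le {F : Type*} [NormedAddCommGroup F] [NormedSpace ℝ F] {k : ℕ}
    {a : ℕ → ℝ → F} {M : ℝ}
    (ha : ∀ i < k, ∀ t ∈ Set.Icc (0 : ℝ) 1, HasDerivAt (a i) (a (i + 1) t) t)
    (hM : ∀ t ∈ Set.Icc (0 : ℝ) 1, ‖a k t‖ ≤ M) {t : ℝ} (ht : t ∈ Set.Icc (0 : ℝ) 1) :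
    ‖a 0 t - ∑ i ∈ Finset.range k, (t ^ i / (i.factorial : ℝ)) • a i 0‖ ≤ M := by
  induction k generalizing a t with
  | zero => simpa using hM t ht
  | succ k ih =>
    have h0 : (0 : ℝ) ∈ Set.Icc (0 : ℝ) 1 := ⟨le_rfl, zero_le_one⟩
    set b : ℝ → F := fun s => a 0 s - ∑ i ∈ Finset.range (k + 1), (s ^ i / (i.factorial : ℝ)) • a i 0
    have hb0 : b 0 = 0 := by
      simp [b, Finset.sum_range_succ']
    -- The derivative of the remainder of order `k + 1` is the remainder of order `k` of the shifted
    -- sequence, which the induction hypothesis bounds; the mean value inequality then integrates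
    -- the bound.
    have hd : ∀ s ∈ Set.Icc (0 : ℝ) 1, HasDerivAt b
        (a 1 s - ∑ i ∈ Finset.range k, (s ^ i / (i.factorial : ℝ)) • a (i + 1) 0) s := by
      intro s hs
      refine (ha 0 (Nat.succ_pos _) s hs).sub ?_
      simp only [Finset.sum_range_succ', pow_zero]
      rw [← add_zero (∑ i ∈ Finset.range k, (s ^ i / (i.factorial : ℝ)) • a (i + 1) 0)]
      refine HasDerivAt.add (HasDerivAt.fun_sum fun i _ => ?_) (hasDerivAt_const _ _)
      have := (((hasDerivAt_pow (i + 1) s).div_const ((i + 1).factorial : ℝ)).smul_const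
        (a (i + 1) 0))
      convert this using 2
      rw [Nat.factorial_succ]
      push_cast
      field_simp
    have hbd : ∀ s ∈ Set.Icc (0 : ℝ) 1,
        ‖a 1 s - ∑ i ∈ Finset.range k, (s ^ i / (i.factorial : ℝ)) • a (i + 1) 0‖ ≤ M :=
      fun s hs => ih (a := fun i => a (i + 1)) (fun i hi => ha (i + 1) (by omega)) hM hs
    have := (convex_Icc (0 : ℝ) 1).norm_image_sub_le_of_norm_hasDerivWithin_le
      (fun s hs => (hd s hs).hasDerivWithinAt) hbd h0 ht
    rw [hb0, sub_zero, sub_zero, Real.norm_of_nonneg ht.1] at this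
    have hM0 : 0 ≤ M := (norm_nonneg _).trans (hbd 0 h0)
    exact this.trans (mul_le_of_le_one_right hM0 ht.2)

/-! ### Smoothing by a kernel of order `p` -/

section Euclidean

variable {d : ℕ} {F : Type} [NormedAddCommGroup F] [NormedSpace ℝ F]

lemma IterDiff.norm_sub_taylor_le {E : Type} [NormedAddCommGroup E] [NormedSpace ℝ E] {k : ℕ}
    {g : E → F} (hg : IterDiff k g) {x v : E} {C : ℝ}
    (hC : ∀ t ∈ Set.Icc (0 : ℝ) 1, ‖iteratedFDeriv ℝ k g (x + t • v)‖ ≤ C) :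
    ‖g (x + v) - ∑ i ∈ Finset.range k, (1 / (i.factorial : ℝ)) •
      iteratedFDeriv ℝ i g x (fun _ => v)‖ ≤ C * ‖v‖ ^ k := by
  have := KernelGreeks.norm_sub_taylor_le (k := k) (t := 1) (M := C * ‖v‖ ^ k)
    (a := fun i s => iteratedFDeriv ℝ i g (x + s • v) (fun _ => v))
    (fun i hi t _ => hg.hasDerivAt_line hi x v t) (fun t ht => by
      refine (ContinuousMultilinearMap.le_opNorm _ _).trans ?_
      simp only [Finset.prod_const, Finset.card_univ, Fintype.card_fin]
      gcongr
      exact hC t ht) ⟨zero_le_one, le_rfl⟩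
  simpa using this

/-- The homogeneous polynomials of degree `0 < r < p` are orthogonal to a kernel of order `p`. -/
lemma AssumptionK.integral_smul_multilinear [CompleteSpace F] {K : EuclideanSpace ℝ (Fin d) → ℝ}
    {p : ℕ} (hK : AssumptionK K p) {r : ℕ} (h0 : 0 < r) (hr : r < p)
    (m : ContinuousMultilinearMap ℝ (fun _ : Fin r => EuclideanSpace ℝ (Fin d)) F) :
    ∫ l, K l • m (fun _ => l) = 0 := by
  set e : Fin d → EuclideanSpace ℝ (Fin d) := fun i => EuclideanSpace.single i 1
  have hexp (l : EuclideanSpace ℝ (Fin d)) : K l • m (fun _ => l) =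
      ∑ j : Fin r → Fin d, ((∏ k, l (j k)) * K l) • m (fun k => e (j k)) := by
    have hl : l = ∑ i, l i • e i := by
      ext i
      simp [e, Pi.single_apply]
    have h1 : m (fun _ => l) = ∑ j : Fin r → Fin d, m (fun k => l (j k) • e (j k)) := by
      conv_lhs => rw [hl]
      exact m.toMultilinearMap.map_sum (fun _ i => l i • e i)
    rw [h1, Finset.smul_sum]
    refine Finset.sum_congr rfl fun j _ => ?_
    rw [m.map_smul_univ, smul_smul, mul_comm]
  simp_rw [hexp]
  have hi (j : Fin r → Fin d) :
      Integrable (fun l : EuclideanSpace ℝ (Fin d) => (∏ k, l (j k)) * K l) :=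
    Continuous.integrable_of_hasCompactSupport
      ((by fun_prop : Continuous fun l : EuclideanSpace ℝ (Fin d) => ∏ k, l (j k)).mul
        hK.contDiff.continuous) hK.compact.mul_left
  rw [integral_finsetSum _ fun j _ => (hi j).smul_const _]
  refine Finset.sum_eq_zero fun j _ => ?_
  rw [integral_smul_const]
  have := hK.order.2.1 r h0 hr j
  rw [kernelMoment] at this
  rw [this, zero_smul]

/-- The bias of smoothing with a kernel of order `p`. -/
lemma AssumptionK.norm_integral_smul_sub_le [CompleteSpace F] {K : EuclideanSpace ℝ (Fin d) → ℝ}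
    {p : ℕ} (hK : AssumptionK K p) {R : ℝ} (hR : ∀ l, K l ≠ 0 → ‖l‖ ≤ R)
    {g : EuclideanSpace ℝ (Fin d) → F} (hg : IterDiff p g) {x : EuclideanSpace ℝ (Fin d)}
    {δ C h : ℝ} (hh : 0 < h) (hhR : h * R < δ)
    (hC : ∀ y ∈ Metric.ball x δ, ‖iteratedFDeriv ℝ p g y‖ ≤ C) :
    ‖(∫ l, K l • g (x - h • l)) - g x‖ ≤ (∫ l, |K l|) * (C * (h * R) ^ p) := by
  obtain ⟨q, rfl⟩ : ∃ q, p = q + 2 := ⟨p - 2, by have := hK.two_le; omega⟩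
  have hgc : Continuous g := (iterDiff_succ_iff.1 hg).1.continuous
  have hKc := hK.contDiff.continuous
  have hint (u : EuclideanSpace ℝ (Fin d) → F) (hu : Continuous u) :
      Integrable (fun l => K l • u l) :=
    (hKc.smul hu).integrable_of_hasCompactSupport hK.compact.smul_right
  have hgi := hint (fun l => g (x - h • l)) (by fun_prop)
  set T : ℕ → EuclideanSpace ℝ (Fin d) → F := fun i l =>
    (1 / (i.factorial : ℝ)) • iteratedFDeriv ℝ i g x (fun _ => -(h • l))
  have hTc (i : ℕ) : Continuous (T i) :=
    ((iteratedFDeriv ℝ i g x).cont.comp (by fun_prop)).const_smul _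
  have hT (i : ℕ) (h0 : 0 < i) (hi : i < q + 2) : ∫ l, K l • T i l = 0 := by
    have heq (l : EuclideanSpace ℝ (Fin d)) : K l • T i l =
        ((1 / (i.factorial : ℝ)) * (-h) ^ i) • (K l • iteratedFDeriv ℝ i g x (fun _ => l)) := by
      have : (fun _ : Fin i => -(h • l)) = fun _ : Fin i => (-h) • l := by simp
      simp only [T]
      rw [this, (iteratedFDeriv ℝ i g x).map_smul_univ (fun _ => -h) (fun _ => l)]
      simp only [Finset.prod_const, Finset.card_univ, Fintype.card_fin, smul_smul]
      congr 1
      ring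
    simp_rw [heq]
    rw [integral_smul, hK.integral_smul_multilinear h0 hi, smul_zero]
  have hT0 : ∫ l, K l • T 0 l = g x := by
    simp [T, integral_smul_const, hK.integral_eq_one]
  -- Integrated against `K`, the Taylor polynomial reduces to its constant term, so the bias is the
  -- integral of the Taylor remainder.
  have hsum : ∫ l, K l • ∑ i ∈ Finset.range (q + 2), T i l = g x := by
    simp_rw [Finset.smul_sum]
    rw [integral_finsetSum _ fun i _ => hint _ (hTc i), Finset.sum_range_succ', hT0,
      Finset.sum_eq_zero, zero_add]
    intro i hi
    exact hT _ (Nat.succ_pos _) (by have := Finset.mem_range.1 hi; omega)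
  rw [← hsum, ← integral_sub hgi (hint _ (continuous_finsetSum _ fun i _ => hTc i)),
    ← integral_mul_const]
  refine norm_integral_le_of_norm_le ((hKc.abs.integrable_of_hasCompactSupport
    hK.compact.abs).mul_const _) (ae_of_all _ fun l => ?_)
  rw [← smul_sub, norm_smul, Real.norm_eq_abs]
  by_cases hl : K l = 0
  · simp [hl]
  have hlR := hR l hl
  have hv : ‖-(h • l)‖ ≤ h * R := by
    rw [norm_neg, norm_smul, Real.norm_of_nonneg hh.le]
    gcongr
  have hball : ∀ t ∈ Set.Icc (0 : ℝ) 1, ‖iteratedFDeriv ℝ (q + 2) g (x + t • -(h • l))‖ ≤ C := by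
    intro t ht
    refine hC _ ?_
    rw [mem_ball_iff_norm, add_sub_cancel_left, norm_smul, Real.norm_of_nonneg ht.1]
    exact (mul_le_of_le_one_left (norm_nonneg _) ht.2).trans_lt (hv.trans_lt hhR)
  have hC0 : 0 ≤ C := (norm_nonneg _).trans (hball 0 ⟨le_rfl, zero_le_one⟩)
  have := hg.norm_sub_taylor_le hball
  rw [← sub_eq_add_neg] at this
  gcongr
  exact this.trans (by gcongr)

/-- Bounds of the oscillation of two successive derivatives bound the higher derivative. -/
lemma norm_iteratedFDeriv_le_of_oscillation {E : Type} [NormedAddCommGroup E] [NormedSpace ℝ E]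
    {k : ℕ} {g : E → F} (hg : IterDiff (k + 1) g) {x : E} {δ C : ℝ} (hδ : 0 < δ)
    (h1 : ∀ y ∈ Metric.ball x δ, ‖iteratedFDeriv ℝ k g y - iteratedFDeriv ℝ k g x‖ ≤ C)
    (h2 : ∀ y ∈ Metric.ball x δ, ‖iteratedFDeriv ℝ (k + 1) g y - iteratedFDeriv ℝ (k + 1) g x‖ ≤ C) :
    ∀ y ∈ Metric.ball x δ, ‖iteratedFDeriv ℝ (k + 1) g y‖ ≤ 2 * (1 + δ⁻¹) * C := by
  set D := fderiv ℝ (iteratedFDeriv ℝ k g) with hD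
  have hC : 0 ≤ C := (norm_nonneg _).trans (h1 x (Metric.mem_ball_self hδ))
  have hosc : ∀ y ∈ Metric.ball x δ, ‖D y - D x‖ ≤ C := by
    intro y hy
    have := h2 y hy
    rw [iteratedFDeriv_succ_eq_comp_left] at this
    rwa [Function.comp_apply, Function.comp_apply, ← dist_eq_norm, LinearIsometryEquiv.dist_map,
      dist_eq_norm] at this
  have hx : ‖D x‖ ≤ (1 + 2 * δ⁻¹) * C := by
    -- Test vectors with `δ / 2 ≤ ‖v‖ < δ` suffice: they stay in the ball, and dividing by their
    -- norm costs a factor at most `2 * δ⁻¹`.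
    refine ContinuousLinearMap.opNorm_le_of_shell (c := (2 : ℝ)) hδ (by positivity) (by simp)
      fun v hv1 hv2 => ?_
    have hv : x + v ∈ Metric.ball x δ := by simpa using hv2
    have hmv := (convex_ball x δ).norm_image_sub_le_of_norm_fderiv_le'
      (fun y _ => hg k k.lt_succ_self y) hosc (Metric.mem_ball_self hδ) hv
    rw [add_sub_cancel_left] at hmv
    have h3 := h1 _ hv
    have h4 : 1 ≤ 2 * δ⁻¹ * ‖v‖ := by
      rw [Real.norm_of_nonneg zero_le_two] at hv1
      calc 1 = 2 * δ⁻¹ * (δ / 2) := by field_simp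
        _ ≤ _ := by gcongr
    calc ‖D x v‖ ≤ ‖iteratedFDeriv ℝ k g (x + v) - iteratedFDeriv ℝ k g x‖ +
          ‖iteratedFDeriv ℝ k g (x + v) - iteratedFDeriv ℝ k g x - D x v‖ := by
          rw [norm_sub_rev _ (D x v)]
          exact norm_le_insert' _ _
      _ ≤ C * (2 * δ⁻¹ * ‖v‖) + C * ‖v‖ :=
          add_le_add (h3.trans (le_mul_of_one_le_right hC h4)) hmv
      _ = _ := by ring
  intro y hy
  rw [← norm_fderiv_iteratedFDeriv]
  calc ‖D y‖ ≤ ‖D x‖ + ‖D y - D x‖ := norm_le_insert' (D y) (D x)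
    _ ≤ (1 + 2 * δ⁻¹) * C + C := add_le_add hx (hosc y hy)
    _ = _ := by ring

end Euclidean

/-! ### Families of densities and the law of the sample -/

section Density

variable {d n : ℕ} {f : EuclideanSpace ℝ (Fin d) → EuclideanSpace ℝ (Fin n) → ℝ}
  {φ : EuclideanSpace ℝ (Fin n) → ℝ}

/-- A jointly measurable family of probability densities, continuous in the parameter. -/
structure IsDensityFamily (f : EuclideanSpace ℝ (Fin d) → EuclideanSpace ℝ (Fin n) → ℝ) : Prop where
  continuous : ∀ z, Continuous fun x => f x z
  measurable : ∀ x, Measurable (f x)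
  nonneg : ∀ x z, 0 ≤ f x z
  integrable : ∀ x, Integrable (f x)
  integral_eq_one : ∀ x, ∫ z, f x z = 1

lemma IsDensityFamily.measurable_uncurry (hf : IsDensityFamily f) :
    Measurable fun q : EuclideanSpace ℝ (Fin d) × EuclideanSpace ℝ (Fin n) => f q.1 q.2 :=
  measurable_uncurry_of_continuous_of_measurable (u := f) hf.continuous hf.measurable

lemma IsDensityFamily.integrable_mul (hf : IsDensityFamily f) (hφ : Measurable φ) {M : ℝ}
    (hM : ∀ z, |φ z| ≤ M) (x : EuclideanSpace ℝ (Fin d)) : Integrable fun z => f x z * φ z :=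
  (hf.integrable x).mul_bdd hφ.aestronglyMeasurable (ae_of_all _ hM)

/-- Scheffé's lemma: a continuous family of densities is continuous in `L¹`. -/
lemma IsDensityFamily.tendsto_integral_abs_sub (hf : IsDensityFamily f)
    (x₀ : EuclideanSpace ℝ (Fin d)) :
    Tendsto (fun x => ∫ z, |f x z - f x₀ z|) (𝓝 x₀) (𝓝 0) := by
  have h1 (x) : ∫ z, |f x z - f x₀ z| = 2 * ∫ z, max (f x₀ z - f x z) 0 := by
    have hi : Integrable fun z => f x₀ z - f x z := (hf.integrable _).sub (hf.integrable _)
    -- Both densities have mass one, so the linear term integrates to zero. The remaining positive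
    -- part is at most `f x₀`, a dominating function independent of `x`.
    have : ∀ z, |f x z - f x₀ z| = 2 * max (f x₀ z - f x z) 0 - (f x₀ z - f x z) := by
      intro z
      rcases le_total (f x z) (f x₀ z) with h | h
      · rw [abs_of_nonpos (by linarith), max_eq_left (by linarith)]; ring
      · rw [abs_of_nonneg (by linarith), max_eq_right (by linarith)]; ring
    simp_rw [this]
    rw [integral_sub (hi.pos_part.const_mul 2) hi, integral_const_mul,
      integral_sub (hf.integrable _) (hf.integrable _), hf.integral_eq_one, hf.integral_eq_one]
    simp
  have h2 : Tendsto (fun x => ∫ z, max (f x₀ z - f x z) 0) (𝓝 x₀) (𝓝 (∫ _ : EuclideanSpace ℝ (Fin n), (0 : ℝ))) := by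
    refine tendsto_integral_filter_of_dominated_convergence (f x₀) ?_ ?_ (hf.integrable x₀) ?_
    · exact Eventually.of_forall fun x =>
        (((hf.measurable x₀).sub (hf.measurable x)).max measurable_const).aestronglyMeasurable
    · refine Eventually.of_forall fun x => ae_of_all _ fun z => ?_
      rw [Real.norm_of_nonneg (le_max_right _ _)]
      exact max_le (by linarith [hf.nonneg x z]) (hf.nonneg x₀ z)
    · refine ae_of_all _ fun z => ?_
      have : Continuous fun x => max (f x₀ z - f x z) 0 :=
        (continuous_const.sub (hf.continuous z)).max continuous_const
      simpa using this.tendsto x₀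
  simp_rw [h1]
  simpa using h2.const_mul 2

/-- Continuity in `L¹` of the densities is tested against a bounded function; no regularity of `φ`
is involved. -/
lemma IsDensityFamily.continuous_integral_mul (hf : IsDensityFamily f) (hφ : Measurable φ) {M : ℝ}
    (hM : ∀ z, |φ z| ≤ M) : Continuous fun x => ∫ z, f x z * φ z := by
  refine continuous_iff_continuousAt.2 fun x₀ => ?_
  have hM0 : 0 ≤ M := (abs_nonneg _).trans (hM 0)
  rw [ContinuousAt, tendsto_iff_norm_sub_tendsto_zero]
  have h := (hf.tendsto_integral_abs_sub x₀).mul_const M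
  rw [zero_mul] at h
  refine squeeze_zero (fun _ => norm_nonneg _) (fun x => ?_) h
  rw [← integral_sub (hf.integrable_mul hφ hM x) (hf.integrable_mul hφ hM x₀), ← integral_mul_const]
  refine norm_integral_le_of_norm_le ((((hf.integrable x).sub (hf.integrable x₀)).abs).mul_const M)
    (ae_of_all _ fun z => ?_)
  rw [← sub_mul, norm_mul, Real.norm_eq_abs, Real.norm_eq_abs]
  exact mul_le_mul_of_nonneg_left (hM z) (abs_nonneg _)

lemma IsDensityFamily.abs_integral_mul_le (hf : IsDensityFamily f) {M : ℝ}
    (hM : ∀ z, |φ z| ≤ M) (x : EuclideanSpace ℝ (Fin d)) : |∫ z, f x z * φ z| ≤ M := by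
  have : ‖∫ z, f x z * φ z‖ ≤ ∫ z, f x z * M :=
    norm_integral_le_of_norm_le ((hf.integrable x).mul_const M) (ae_of_all _ fun z => by
      rw [norm_mul, Real.norm_of_nonneg (hf.nonneg x z), Real.norm_eq_abs]
      exact mul_le_mul_of_nonneg_left (hM z) (hf.nonneg x z))
  simpa [integral_mul_const, hf.integral_eq_one] using this

lemma IsDensityFamily.integrable_prod (hf : IsDensityFamily f) {u : EuclideanSpace ℝ (Fin d) → ℝ}
    (hu : Integrable u) :
    Integrable fun q : EuclideanSpace ℝ (Fin d) × EuclideanSpace ℝ (Fin n) =>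
      u q.1 * f q.1 q.2 := by
  rw [Measure.volume_eq_prod]
  have hm : AEStronglyMeasurable (fun q : EuclideanSpace ℝ (Fin d) × EuclideanSpace ℝ (Fin n) =>
      u q.1 * f q.1 q.2) (volume.prod volume) :=
    hu.aestronglyMeasurable.comp_fst.mul hf.measurable_uncurry.aestronglyMeasurable
  refine (integrable_prod_iff hm).2 ⟨ae_of_all _ fun x => (hf.integrable x).const_mul (u x), ?_⟩
  refine hu.norm.congr (ae_of_all _ fun x => ?_)
  simp only [norm_mul, integral_const_mul, Real.norm_of_nonneg (hf.nonneg _ _),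
    hf.integral_eq_one, mul_one]

variable {x₀ : EuclideanSpace ℝ (Fin d)} {ℓ : EuclideanSpace ℝ (Fin d) → ℝ}
  {W : Type*} [NormedAddCommGroup W] [NormedSpace ℝ W]

lemma integrable_randomizedLaw_iff (hf : IsDensityFamily f) (hℓ : Measurable ℓ)
    (hℓ0 : ∀ x, 0 ≤ ℓ x) {F : EuclideanSpace ℝ (Fin d) × EuclideanSpace ℝ (Fin n) → W} :
    Integrable F (randomizedLaw x₀ ℓ f) ↔
      Integrable (fun q => (ℓ (x₀ - q.1) * f q.1 q.2) • F q) := by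
  have hm : Measurable fun q : EuclideanSpace ℝ (Fin d) × EuclideanSpace ℝ (Fin n) =>
      ENNReal.ofReal (ℓ (x₀ - q.1) * f q.1 q.2) :=
    ((hℓ.comp (measurable_const.sub measurable_fst)).mul hf.measurable_uncurry).ennreal_ofReal
  rw [randomizedLaw, integrable_withDensity_iff_integrable_smul' hm (by simp)]
  simp only [ENNReal.toReal_ofReal (mul_nonneg (hℓ0 _) (hf.nonneg _ _))]

lemma integral_randomizedLaw (hf : IsDensityFamily f) (hℓ : Measurable ℓ)
    (hℓ0 : ∀ x, 0 ≤ ℓ x) {F : EuclideanSpace ℝ (Fin d) × EuclideanSpace ℝ (Fin n) → W} :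
    ∫ q, F q ∂(randomizedLaw x₀ ℓ f) = ∫ q, (ℓ (x₀ - q.1) * f q.1 q.2) • F q := by
  have hm : Measurable fun q : EuclideanSpace ℝ (Fin d) × EuclideanSpace ℝ (Fin n) =>
      ENNReal.ofReal (ℓ (x₀ - q.1) * f q.1 q.2) :=
    ((hℓ.comp (measurable_const.sub measurable_fst)).mul hf.measurable_uncurry).ennreal_ofReal
  rw [randomizedLaw, integral_withDensity_eq_integral_toReal_smul hm (by simp)]
  simp only [ENNReal.toReal_ofReal (mul_nonneg (hℓ0 _) (hf.nonneg _ _))]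

end Density

/-! ### The rescaled score and its small bandwidth limit -/

section Score

variable {d : ℕ} {K ℓ : EuclideanSpace ℝ (Fin d) → ℝ}

lemma inner_gradient (u : EuclideanSpace ℝ (Fin d) → ℝ) (x t : EuclideanSpace ℝ (Fin d)) :
    ⟪gradient u x, t⟫_ℝ = fderiv ℝ u x t := by
  rw [gradient, InnerProductSpace.toDual_symm_apply]

lemma continuous_gradient (hK : ContDiff ℝ 1 K) : Continuous (gradient K) :=
  (InnerProductSpace.toDual ℝ _).symm.continuous.comp (hK.continuous_fderiv one_ne_zero)

lemma gradient_eq_zero_of_notMem_tsupport {x : EuclideanSpace ℝ (Fin d)} (hx : x ∉ tsupport K) :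
    gradient K x = 0 := by
  rw [gradient, fderiv_of_notMem_tsupport ℝ hx, map_zero]

lemma hasCompactSupport_gradient (hK : HasCompactSupport K) : HasCompactSupport (gradient K) :=
  HasCompactSupport.intro hK fun _ hx => gradient_eq_zero_of_notMem_tsupport hx

/-- A nonnegative function has a vanishing gradient at its zeros. -/
lemma mul_inv_smul_gradient (hℓ0 : ∀ x, 0 ≤ ℓ x) (y : EuclideanSpace ℝ (Fin d)) :
    ℓ y • ((ℓ y)⁻¹ • gradient ℓ y) = gradient ℓ y := by
  by_cases h : ℓ y = 0
  · have : IsLocalMin ℓ y := Eventually.of_forall fun x => h ▸ hℓ0 x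
    rw [gradient, this.fderiv_eq_zero]
    simp
  · rw [smul_smul, mul_inv_cancel₀ h, one_smul]

/-- The summand of the estimator, without the payoff, as a function of the rescaled variable
`l = (x₀ - x) / h`. -/
def rescaledScore (K ℓ : EuclideanSpace ℝ (Fin d) → ℝ) (h : ℝ) (l : EuclideanSpace ℝ (Fin d)) :
    EuclideanSpace ℝ (Fin d) :=
  gradient K l + (h * K l) • ((ℓ (h • l))⁻¹ • gradient ℓ (h • l))

lemma measurable_rescaledScore (hK : ContDiff ℝ 1 K) (hℓ : ContDiff ℝ 1 ℓ) (h : ℝ) :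
    Measurable (rescaledScore K ℓ h) := by
  have h1 := (continuous_gradient hK).measurable
  have h2 := (continuous_gradient hℓ).measurable
  have h3 := hK.continuous.measurable
  have h4 := hℓ.continuous.measurable
  unfold rescaledScore
  fun_prop

lemma rescaledScore_eq_zero {h : ℝ} {l : EuclideanSpace ℝ (Fin d)} (hl : l ∉ tsupport K) :
    rescaledScore K ℓ h l = 0 := by
  simp [rescaledScore, gradient_eq_zero_of_notMem_tsupport hl, image_eq_zero_of_notMem_tsupport hl]

lemma smul_rescaledScore (hℓ0 : ∀ x, 0 ≤ ℓ x) (h : ℝ) (l : EuclideanSpace ℝ (Fin d)) :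
    ℓ (h • l) • rescaledScore K ℓ h l = ℓ (h • l) • gradient K l + (h * K l) • gradient ℓ (h • l) := by
  rw [rescaledScore, smul_add, smul_comm _ (h * K l), mul_inv_smul_gradient hℓ0]

lemma tendsto_rescaledScore (hℓ : ContDiff ℝ 1 ℓ) (hℓ0 : ℓ 0 ≠ 0) (l : EuclideanSpace ℝ (Fin d)) :
    Tendsto (fun h => rescaledScore K ℓ h l) (𝓝 0) (𝓝 (gradient K l)) := by
  have h1 : ContinuousAt (fun h : ℝ => rescaledScore K ℓ h l) 0 := by
    unfold rescaledScore
    have h2 : ContinuousAt (fun h : ℝ => ℓ (h • l)) 0 :=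
      (hℓ.continuous.comp (by fun_prop)).continuousAt
    have h3 : ContinuousAt (fun h : ℝ => gradient ℓ (h • l)) 0 :=
      ((continuous_gradient hℓ).comp (by fun_prop)).continuousAt
    exact continuousAt_const.add (((continuousAt_id.mul continuousAt_const)).smul
      ((h2.inv₀ (by simpa using hℓ0)).smul h3))
  simpa [ContinuousAt, rescaledScore] using h1

/-- The score is bounded uniformly in small bandwidths. -/
lemma eventually_norm_rescaledScore_le (hK : ContDiff ℝ 1 K) (hKc : HasCompactSupport K)
    (hℓ : ContDiff ℝ 1 ℓ) (hℓ0 : ℓ 0 ≠ 0) :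
    ∃ B, 0 ≤ B ∧ ∀ᶠ h in 𝓝 (0 : ℝ), ∀ l, ‖rescaledScore K ℓ h l‖ ≤ B ∧
      (l ∈ tsupport K → |ℓ (h • l)| ≤ B) := by
  obtain ⟨R, hR⟩ := hKc.isCompact.isBounded.exists_norm_le
  obtain ⟨CK, hCK⟩ := hK.continuous.bounded_above_of_compact_support hKc
  obtain ⟨CG, hCG⟩ := (continuous_gradient hK).bounded_above_of_compact_support
    (hasCompactSupport_gradient hKc)
  have hCG0 : 0 ≤ CG := (norm_nonneg _).trans (hCG 0)
  have hCK0 : 0 ≤ CK := (norm_nonneg _).trans (hCK 0)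
  have hD : ContinuousAt (fun y => ‖(ℓ y)⁻¹ • gradient ℓ y‖) 0 :=
    ((hℓ.continuous.continuousAt.inv₀ hℓ0).smul (continuous_gradient hℓ).continuousAt).norm
  have hL : ContinuousAt (fun y => |ℓ y|) 0 := hℓ.continuous.abs.continuousAt
  have hev := (hD.eventually_lt_const (lt_add_one _)).and (hL.eventually_lt_const (lt_add_one _))
  obtain ⟨δ, hδ, hball⟩ := Metric.eventually_nhds_iff_ball.1 hev
  set CD := ‖(ℓ 0)⁻¹ • gradient ℓ 0‖ + 1
  have hCD0 : 0 ≤ CD := by positivity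
  refine ⟨(CG + CK * CD) + (|ℓ 0| + 1), by positivity, ?_⟩
  have h1 : ∀ᶠ h in 𝓝 (0 : ℝ), |h| < 1 := by
    have : Tendsto (fun h : ℝ => |h|) (𝓝 0) (𝓝 0) := by simpa using continuous_abs.tendsto (0 : ℝ)
    exact this.eventually_lt_const one_pos
  have h2 : ∀ᶠ h in 𝓝 (0 : ℝ), |h| * |R| < δ := by
    have : Tendsto (fun h : ℝ => |h| * |R|) (𝓝 0) (𝓝 0) := by
      simpa using (continuous_abs.tendsto (0 : ℝ)).mul_const |R|
    exact this.eventually_lt_const hδ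
  filter_upwards [h1, h2] with h h1 h2 l
  by_cases hl : l ∈ tsupport K
  · have hm : h • l ∈ Metric.ball (0 : EuclideanSpace ℝ (Fin d)) δ := by
      rw [mem_ball_zero_iff, norm_smul, Real.norm_eq_abs]
      refine lt_of_le_of_lt ?_ h2
      gcongr
      exact (hR l hl).trans (le_abs_self R)
    obtain ⟨h3, h4⟩ := hball _ hm
    refine ⟨?_, fun _ => h4.le.trans (le_add_of_nonneg_left (by positivity))⟩
    refine le_trans ?_ (le_add_of_nonneg_right (by positivity))
    refine (norm_add_le _ _).trans (add_le_add (hCG l) ?_)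
    rw [norm_smul, norm_mul]
    gcongr
    · exact (mul_le_of_le_one_left (norm_nonneg _) h1.le).trans (hCK l)
  · refine ⟨?_, fun h => absurd h hl⟩
    rw [rescaledScore_eq_zero hl, norm_zero]
    positivity

lemma integral_comp_rescale {W : Type*} [NormedAddCommGroup W] [NormedSpace ℝ W]
    (G : EuclideanSpace ℝ (Fin d) → W) (x₀ : EuclideanSpace ℝ (Fin d)) {h : ℝ} (hh : 0 < h) :
    ∫ x, G (h⁻¹ • (x₀ - x)) = h ^ d • ∫ l, G l := by
  rw [integral_sub_left_eq_self (fun y => G (h⁻¹ • y)) volume x₀, Measure.integral_comp_inv_smul]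
  simp [abs_of_pos hh]

/-- The limit of the rescaled moments of the summands of the estimator. -/
lemma tendsto_integral_rescaledScore_pow (hK : ContDiff ℝ 1 K) (hKc : HasCompactSupport K)
    (hℓ : ContDiff ℝ 1 ℓ) (hℓ0 : ℓ 0 ≠ 0) {m : EuclideanSpace ℝ (Fin d) → ℝ} (hm : Continuous m)
    {M : ℝ} (hM : ∀ x, |m x| ≤ M) (x₀ t : EuclideanSpace ℝ (Fin d)) {k : ℕ} (hk : k ≠ 0) :
    Tendsto (fun h : ℝ => ∫ l, ℓ (h • l) * ⟪rescaledScore K ℓ h l, t⟫_ℝ ^ k * m (x₀ - h • l)) (𝓝 0)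
      (𝓝 (ℓ 0 * m x₀ * ∫ l, ⟪gradient K l, t⟫_ℝ ^ k)) := by
  obtain ⟨B, hB0, hB⟩ := eventually_norm_rescaledScore_le hK hKc hℓ hℓ0
  have hlim : ℓ 0 * m x₀ * ∫ l, ⟪gradient K l, t⟫_ℝ ^ k
      = ∫ l, ℓ 0 * ⟪gradient K l, t⟫_ℝ ^ k * m x₀ := by
    rw [← integral_const_mul]
    congr 1 with l
    ring
  rw [hlim]
  refine tendsto_integral_filter_of_dominated_convergence
    -- Outside the support of `K` the score vanishes, hence so does its `k`-th power because `k ≠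
    -- 0`; a constant on this compact set therefore dominates.
    ((tsupport K).indicator fun _ => B * (B * ‖t‖) ^ k * M) ?_ ?_ ?_ ?_
  · refine Eventually.of_forall fun h => Measurable.aestronglyMeasurable ?_
    have h1 := measurable_rescaledScore hK hℓ h
    have h2 := hm.measurable
    have h3 := hℓ.continuous.measurable
    fun_prop
  · filter_upwards [hB] with h hB
    refine ae_of_all _ fun l => ?_
    by_cases hl : l ∈ tsupport K
    · rw [Set.indicator_of_mem hl, norm_mul, norm_mul, norm_pow]
      have h1 : ‖⟪rescaledScore K ℓ h l, t⟫_ℝ‖ ≤ B * ‖t‖ :=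
        (norm_inner_le_norm _ _).trans (by gcongr; exact (hB l).1)
      gcongr
      · exact (hB l).2 hl
      · exact hM _
    · rw [Set.indicator_of_notMem hl, rescaledScore_eq_zero hl]
      simp [hk]
  · rw [integrable_indicator_iff (isClosed_tsupport K).measurableSet]
    exact integrableOn_const hKc.isCompact.measure_lt_top.ne
  · refine ae_of_all _ fun l => ?_
    have hs : Tendsto (fun h : ℝ => h • l) (𝓝 0) (𝓝 0) := by
      simpa using (by fun_prop : Continuous fun h : ℝ => h • l).tendsto 0
    have h1 := (hℓ.continuous.tendsto 0).comp hs
    have h2 : Tendsto (fun h : ℝ => m (x₀ - h • l)) (𝓝 0) (𝓝 (m x₀)) := by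
      have := (tendsto_const_nhds (x := x₀)).sub hs
      rw [sub_zero] at this
      exact (hm.tendsto x₀).comp this
    exact (h1.mul (((tendsto_rescaledScore hℓ hℓ0 l).inner tendsto_const_nhds).pow k)).mul h2

end Score

/-! ### The limiting covariance as a quadratic form -/

section Covariance

variable {d : ℕ} {K ℓ : EuclideanSpace ℝ (Fin d) → ℝ}

lemma dotProduct_asymptoticCov_mulVec (hK : ContDiff ℝ 1 K) (hKc : HasCompactSupport K) (m : ℝ)
    (t : EuclideanSpace ℝ (Fin d)) :
    t ⬝ᵥ asymptoticCov K ℓ m *ᵥ t = m / ℓ 0 * ∫ l, ⟪gradient K l, t⟫_ℝ ^ 2 := by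
  have hg := continuous_gradient hK
  have hi (i j : Fin d) : Integrable fun l => gradient K l i * gradient K l j := by
    refine Continuous.integrable_of_hasCompactSupport (by fun_prop) ?_
    refine HasCompactSupport.intro hKc fun x hx => ?_
    simp [gradient_eq_zero_of_notMem_tsupport hx]
  have hexp (l : EuclideanSpace ℝ (Fin d)) : ⟪gradient K l, t⟫_ℝ ^ 2 =
      ∑ i, ∑ j, t i * t j * (gradient K l i * gradient K l j) := by
    rw [PiLp.inner_apply, sq, Finset.sum_mul_sum]
    refine Finset.sum_congr rfl fun i _ => Finset.sum_congr rfl fun j _ => ?_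
    simp only [RCLike.inner_apply, conj_trivial]
    ring
  simp_rw [hexp]
  rw [integral_finsetSum _ fun i _ => integrable_finsetSum _ fun j _ => (hi i j).const_mul _]
  simp_rw [integral_finsetSum _ fun j _ => (hi _ j).const_mul _, integral_const_mul]
  simp only [asymptoticCov, dotProduct, Matrix.mulVec, Matrix.smul_apply, Matrix.of_apply,
    smul_eq_mul, Finset.mul_sum]
  refine Finset.sum_congr rfl fun i _ => Finset.sum_congr rfl fun j _ => ?_
  ring

lemma posSemidef_asymptoticCov (hK : ContDiff ℝ 1 K) (hKc : HasCompactSupport K) {m : ℝ}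
    (hm : 0 ≤ m) (hℓ : 0 ≤ ℓ 0) : (asymptoticCov K ℓ m).PosSemidef := by
  refine Matrix.PosSemidef.of_dotProduct_mulVec_nonneg ?_ fun t => ?_
  · ext i j
    simp [asymptoticCov, mul_comm]
  · have := dotProduct_asymptoticCov_mulVec (ℓ := ℓ) hK hKc m (WithLp.toLp 2 t)
    simp only [star_trivial] at *
    rw [this]
    exact mul_nonneg (div_nonneg hm hℓ) (integral_nonneg fun _ => sq_nonneg _)

end Covariance

/-! ### Integrability and moments of one summand -/

section Summand

variable {d n : ℕ} {K ℓ : EuclideanSpace ℝ (Fin d) → ℝ}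
  {f : EuclideanSpace ℝ (Fin d) → EuclideanSpace ℝ (Fin n) → ℝ}
  {φ : EuclideanSpace ℝ (Fin n) → ℝ} {x₀ : EuclideanSpace ℝ (Fin d)} {M : ℝ}

/-- The summand of the estimator, as a function of the sample point. -/
def summand (K ℓ : EuclideanSpace ℝ (Fin d) → ℝ) (φ : EuclideanSpace ℝ (Fin n) → ℝ)
    (x₀ : EuclideanSpace ℝ (Fin d)) (h : ℝ)
    (q : EuclideanSpace ℝ (Fin d) × EuclideanSpace ℝ (Fin n)) : EuclideanSpace ℝ (Fin d) :=
  φ q.2 • rescaledScore K ℓ h (h⁻¹ • (x₀ - q.1))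

lemma betaHat_eq_sum {h : ℝ} (hh : h ≠ 0) (N : ℕ) (x : ℕ → EuclideanSpace ℝ (Fin d))
    (z : ℕ → EuclideanSpace ℝ (Fin n)) :
    betaHat K ℓ φ x₀ N h x z = ∑ i ∈ Finset.range N,
      (1 / (ℓ 0 * N * h ^ (d + 1))) • summand K ℓ φ x₀ h (x i, z i) := by
  simp only [betaHat, summand, rescaledScore, ← Finset.smul_sum, smul_inv_smul₀ hh]

lemma measurable_summand (hK : ContDiff ℝ 1 K) (hℓ : ContDiff ℝ 1 ℓ) (hφ : Measurable φ) (h : ℝ) :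
    Measurable (summand K ℓ φ x₀ h) := by
  have := measurable_rescaledScore hK hℓ h
  unfold summand
  fun_prop

/-- For a fixed bandwidth the score may be unbounded, as `∇ℓ / ℓ` can blow up near zeros of `ℓ`. The
sampling density supplies a factor `ℓ` which cancels the quotient and leaves a continuous compactly
supported function of the rescaled variable. -/
lemma integrable_summand (hf : IsDensityFamily f) (hK : ContDiff ℝ 1 K) (hKc : HasCompactSupport K)
    (hℓ : ContDiff ℝ 1 ℓ) (hℓ0 : ∀ x, 0 ≤ ℓ x) (hφ : Measurable φ) (hM : ∀ z, |φ z| ≤ M)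
    {h : ℝ} (hh : h ≠ 0) : Integrable (summand K ℓ φ x₀ h) (randomizedLaw x₀ ℓ f) := by
  have hℓm := hℓ.continuous.measurable
  rw [integrable_randomizedLaw_iff hf hℓm hℓ0]
  set U : EuclideanSpace ℝ (Fin d) → ℝ := fun l =>
    M * ‖ℓ (h • l) • gradient K l + (h * K l) • gradient ℓ (h • l)‖
  have hU : Integrable U := by
    have h1 := continuous_gradient hK
    have h2 := continuous_gradient hℓ
    have h3 := hK.continuous
    have h4 := hℓ.continuous
    refine Continuous.integrable_of_hasCompactSupport (by fun_prop) ?_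
    refine HasCompactSupport.intro hKc fun x hx => ?_
    simp [U, gradient_eq_zero_of_notMem_tsupport hx, image_eq_zero_of_notMem_tsupport hx]
  have hu : Integrable fun x => U (h⁻¹ • (x₀ - x)) :=
    (hU.comp_smul (inv_ne_zero hh)).comp_sub_left x₀
  refine (hf.integrable_prod hu).mono' ?_ (ae_of_all _ fun q => ?_)
  · have h1 := measurable_summand (x₀ := x₀) hK hℓ hφ h
    have h2 := hf.measurable_uncurry
    exact Measurable.aestronglyMeasurable (by fun_prop)
  · have := smul_rescaledScore (K := K) hℓ0 h (h⁻¹ • (x₀ - q.1))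
    rw [smul_inv_smul₀ hh] at this
    simp only [U]
    rw [smul_inv_smul₀ hh, ← this, summand, norm_smul, norm_smul, norm_smul, norm_mul,
      Real.norm_of_nonneg (hf.nonneg _ _), Real.norm_eq_abs (φ _)]
    have h1 := hM q.2
    have h2 := hf.nonneg q.1 q.2
    calc _ = |φ q.2| * (‖ℓ (x₀ - q.1)‖ * ‖rescaledScore K ℓ h (h⁻¹ • (x₀ - q.1))‖) * f q.1 q.2 := by
          ring
      _ ≤ _ := by gcongr

lemma norm_summand_le {h B : ℝ} (hM : ∀ z, |φ z| ≤ M) (hB : ∀ l, ‖rescaledScore K ℓ h l‖ ≤ B)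
    (q : EuclideanSpace ℝ (Fin d) × EuclideanSpace ℝ (Fin n)) :
    ‖summand K ℓ φ x₀ h q‖ ≤ M * B := by
  rw [summand, norm_smul]
  exact mul_le_mul (hM _) (hB _) (norm_nonneg _) ((abs_nonneg _).trans (hM q.2))

/-- The moments of the summands, as integrals in the rescaled variable. -/
lemma integral_inner_summand_pow (hf : IsDensityFamily f) (hℓ : Measurable ℓ)
    (hℓ0 : ∀ x, 0 ≤ ℓ x) (t : EuclideanSpace ℝ (Fin d)) (k : ℕ) {h : ℝ} (hh : 0 < h)
    (hi : Integrable (fun q => ⟪summand K ℓ φ x₀ h q, t⟫_ℝ ^ k) (randomizedLaw x₀ ℓ f)) :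
    ∫ q, ⟪summand K ℓ φ x₀ h q, t⟫_ℝ ^ k ∂(randomizedLaw x₀ ℓ f) =
      h ^ d * ∫ l, ℓ (h • l) * ⟪rescaledScore K ℓ h l, t⟫_ℝ ^ k *
        ∫ z, f (x₀ - h • l) z * φ z ^ k := by
  rw [integrable_randomizedLaw_iff hf hℓ hℓ0, Measure.volume_eq_prod] at hi
  rw [integral_randomizedLaw hf hℓ hℓ0, Measure.volume_eq_prod, integral_prod _ hi, ← smul_eq_mul,
    ← integral_comp_rescale _ x₀ hh]
  congr 1 with x
  rw [smul_inv_smul₀ hh.ne', sub_sub_cancel, ← integral_const_mul]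
  congr 1 with z
  simp only [summand, real_inner_smul_left, smul_eq_mul, mul_pow]
  ring

end Summand

/-! ### Asymptotic normality around the mean -/

section CentralLimit

variable {d n : ℕ} {Ω : Type*} [MeasurableSpace Ω] {P : Measure Ω}
  {K ℓ : EuclideanSpace ℝ (Fin d) → ℝ}
  {f : EuclideanSpace ℝ (Fin d) → EuclideanSpace ℝ (Fin n) → ℝ}
  {φ : EuclideanSpace ℝ (Fin n) → ℝ} {x₀ : EuclideanSpace ℝ (Fin d)} {M : ℝ}
  {Λ : ℕ → Ω → EuclideanSpace ℝ (Fin d)} {Zs : ℕ → Ω → EuclideanSpace ℝ (Fin n)}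

lemma integrable_betaHat (hf : IsDensityFamily f) (hK : ContDiff ℝ 1 K)
    (hKc : HasCompactSupport K) (hℓ : ContDiff ℝ 1 ℓ) (hℓ0 : ∀ x, 0 ≤ ℓ x) (hφ : Measurable φ)
    (hM : ∀ z, |φ z| ≤ M)
    (h_law : ∀ i, HasLaw (fun ω => (Λ i ω, Zs i ω)) (randomizedLaw x₀ ℓ f) P)
    {h : ℝ} (hh : 0 < h) (N : ℕ) :
    Integrable (fun ω => betaHat K ℓ φ x₀ N h (fun i => Λ i ω) (fun i => Zs i ω)) P := by
  simp_rw [betaHat_eq_sum hh.ne']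
  refine integrable_finsetSum _ fun i _ => Integrable.fun_smul _ ?_
  have := integrable_summand (x₀ := x₀) hf hK hKc hℓ hℓ0 hφ hM hh.ne'
  rw [← (h_law i).map_eq] at this
  exact this.comp_aemeasurable (h_law i).aemeasurable

/-- The factor `N` is left uncancelled so that the identity also covers `N = 0`. -/
lemma integral_betaHat (hf : IsDensityFamily f) (hK : ContDiff ℝ 1 K)
    (hKc : HasCompactSupport K) (hℓ : ContDiff ℝ 1 ℓ) (hℓ0 : ∀ x, 0 ≤ ℓ x) (hφ : Measurable φ)
    (hM : ∀ z, |φ z| ≤ M)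
    (h_law : ∀ i, HasLaw (fun ω => (Λ i ω, Zs i ω)) (randomizedLaw x₀ ℓ f) P)
    {h : ℝ} (hh : 0 < h) (N : ℕ) :
    ∫ ω, betaHat K ℓ φ x₀ N h (fun i => Λ i ω) (fun i => Zs i ω) ∂P =
      (N * (1 / (ℓ 0 * N * h ^ (d + 1)))) • ∫ q, summand K ℓ φ x₀ h q ∂(randomizedLaw x₀ ℓ f) := by
  simp_rw [betaHat_eq_sum hh.ne']
  have hi := integrable_summand (x₀ := x₀) hf hK hKc hℓ hℓ0 hφ hM hh.ne'
  have h1 (i : ℕ) : Integrable (fun ω => summand K ℓ φ x₀ h (Λ i ω, Zs i ω)) P := by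
    rw [← (h_law i).map_eq] at hi
    exact hi.comp_aemeasurable (h_law i).aemeasurable
  have h2 (i : ℕ) : ∫ ω, summand K ℓ φ x₀ h (Λ i ω, Zs i ω) ∂P =
      ∫ q, summand K ℓ φ x₀ h q ∂(randomizedLaw x₀ ℓ f) :=
    (h_law i).integral_comp hi.aestronglyMeasurable
  rw [integral_finsetSum _ fun i _ => (h1 i).fun_smul _]
  simp_rw [integral_smul, h2]
  rw [Finset.sum_const, Finset.card_range, ← Nat.cast_smul_eq_nsmul ℝ, smul_smul]

/-- The asymptotic normality of the estimator, centered at its mean. -/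
theorem tendstoInDistribution_betaHat_sub_integral [IsProbabilityMeasure P] (hd : d ≠ 0) (hf : IsDensityFamily f)
    (hK : ContDiff ℝ 1 K) (hKc : HasCompactSupport K) (hℓ : ContDiff ℝ 1 ℓ) (hℓ0 : ∀ x, 0 ≤ ℓ x)
    (hℓ_zero : 0 < ℓ 0) (hφ : Measurable φ) (hM : ∀ z, |φ z| ≤ M)
    (h_law : ∀ i, HasLaw (fun ω => (Λ i ω, Zs i ω)) (randomizedLaw x₀ ℓ f) P)
    (h_indep : iIndepFun (fun i ω => (Λ i ω, Zs i ω)) P)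
    {h : ℕ → ℝ} (h_pos : ∀ N, 0 < h N) (h_zero : Tendsto h atTop (𝓝 0))
    (h_rate : Tendsto (fun N : ℕ => (N : ℝ) * h N ^ (d + 2)) atTop atTop) :
    TendstoInDistribution (fun (N : ℕ) ω => Real.sqrt ((N : ℝ) * h N ^ (d + 2)) •
        (betaHat K ℓ φ x₀ N (h N) (fun i => Λ i ω) (fun i => Zs i ω) -
          ∫ ω', betaHat K ℓ φ x₀ N (h N) (fun i => Λ i ω') (fun i => Zs i ω') ∂P)) atTop id
      (fun _ => P) (multivariateGaussian 0 (asymptoticCov K ℓ (∫ z, f x₀ z * φ z ^ 2))) := by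
  set μ := randomizedLaw x₀ ℓ f with hμ
  have hμP : IsProbabilityMeasure μ := (h_law 0).isProbabilityMeasure_iff.1 inferInstance
  have hM0 : 0 ≤ M := (abs_nonneg _).trans (hM 0)
  set Y : ℕ → EuclideanSpace ℝ (Fin d) × EuclideanSpace ℝ (Fin n) → EuclideanSpace ℝ (Fin d) :=
    fun N => summand K ℓ φ x₀ (h N)
  have hYm (N : ℕ) : Measurable (Y N) := measurable_summand hK hℓ hφ _
  have hYi (N : ℕ) : Integrable (Y N) μ := integrable_summand hf hK hKc hℓ hℓ0 hφ hM (h_pos N).ne'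
  -- This normalization satisfies `N a² = ℓ(0)⁻² h ^ (-d)`, which offsets the factor `h ^ d` of the
  -- rescaled moments. It tends to zero since `N h ^ d ≥ N h ^ (d + 2)` as soon as `h ≤ 1`.
  set a : ℕ → ℝ := fun N => Real.sqrt ((N : ℝ) * h N ^ (d + 2)) * (1 / (ℓ 0 * N * h N ^ (d + 1)))
  set G : ℕ → EuclideanSpace ℝ (Fin d) × EuclideanSpace ℝ (Fin n) → EuclideanSpace ℝ (Fin d) :=
    fun N q => a N • (Y N q - ∫ q, Y N q ∂μ)
  have hGm (N : ℕ) : Measurable (G N) := ((hYm N).sub_const _).const_smul (a N)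
  have hsum (N : ℕ) (ω : Ω) : Real.sqrt ((N : ℝ) * h N ^ (d + 2)) •
      (betaHat K ℓ φ x₀ N (h N) (fun i => Λ i ω) (fun i => Zs i ω) -
          ∫ ω', betaHat K ℓ φ x₀ N (h N) (fun i => Λ i ω') (fun i => Zs i ω') ∂P)
      = ∑ i ∈ Finset.range N, G N (Λ i ω, Zs i ω) := by
    rw [integral_betaHat hf hK hKc hℓ hℓ0 hφ hM h_law (h_pos N), betaHat_eq_sum (h_pos N).ne']
    simp only [G, Y, a, ← Finset.smul_sum, Finset.sum_sub_distrib, Finset.sum_const,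
      Finset.card_range, ← Nat.cast_smul_eq_nsmul ℝ, mul_smul, smul_sub]
    rw [smul_comm (N : ℝ) (1 / (ℓ 0 * N * h N ^ (d + 1)))]
  simp_rw [hsum]
  -- the scaling factors
  have hsq (N : ℕ) (hN : N ≠ 0) : N * a N ^ 2 = (ℓ 0)⁻¹ ^ 2 * (h N ^ d)⁻¹ := by
    have h1 := (h_pos N).ne'
    have h2 : (N : ℝ) ≠ 0 := Nat.cast_ne_zero.2 hN
    have h3 := hℓ_zero.ne'
    simp only [a, mul_pow]
    rw [Real.sq_sqrt (mul_nonneg (Nat.cast_nonneg _) (pow_nonneg (h_pos N).le _))]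
    field_simp
    ring
  have ha0 (N : ℕ) : 0 ≤ a N := by
    have := (h_pos N).le
    have := hℓ_zero.le
    positivity
  have hrate' : Tendsto (fun N : ℕ => (N : ℝ) * h N ^ d) atTop atTop := by
    refine tendsto_atTop_mono' _ ?_ h_rate
    filter_upwards [h_zero.eventually_le_const one_pos] with N hN
    have := (h_pos N).le
    gcongr ?_ * ?_
    exact pow_le_pow_of_le_one this hN (by omega)
  have ha : Tendsto a atTop (𝓝 0) := by
    have h1 : Tendsto (fun N => a N ^ 2) atTop (𝓝 0) := by
      have h2 : Tendsto (fun N : ℕ => (ℓ 0)⁻¹ ^ 2 * ((N : ℝ) * h N ^ d)⁻¹) atTop (𝓝 0) := by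
        have := hrate'.inv_tendsto_atTop.const_mul ((ℓ 0)⁻¹ ^ 2)
        rw [mul_zero] at this
        exact this
      refine h2.congr' ?_
      filter_upwards [eventually_ne_atTop 0] with N hN
      have h2 : (N : ℝ) ≠ 0 := Nat.cast_ne_zero.2 hN
      rw [mul_inv, mul_left_comm, ← hsq N hN, inv_mul_cancel_left₀ h2]
    have h3 := h1.sqrt
    simpa [Real.sqrt_sq (ha0 _)] using h3
  obtain ⟨B, hB0, hB⟩ := eventually_norm_rescaledScore_le hK hKc hℓ hℓ_zero.ne'
  have hBN : ∀ᶠ N in atTop, ∀ q, ‖Y N q‖ ≤ M * B := by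
    filter_upwards [h_zero.eventually hB] with N hN q
    exact norm_summand_le hM (fun l => (hN l).1) q
  have hlawG (N : ℕ) {W : Type} [NormedAddCommGroup W] [NormedSpace ℝ W]
      {u : EuclideanSpace ℝ (Fin d) → W} (hu : Continuous u) :
      ∫ ω, u (G N (Λ 0 ω, Zs 0 ω)) ∂P = ∫ q, u (G N q) ∂μ :=
    (h_law 0).integral_comp (hu.comp_aestronglyMeasurable (hGm N).aestronglyMeasurable)
  have hm1 := hf.continuous_integral_mul hφ hM
  have hM2 : ∀ z, |φ z ^ 2| ≤ M ^ 2 := fun z => by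
    rw [abs_pow]
    exact pow_le_pow_left₀ (abs_nonneg _) (hM z) 2
  have hm2 := hf.continuous_integral_mul (hφ.pow_const 2) hM2
  refine tendstoInDistribution_sum_of_small (X := fun N i ω => G N (Λ i ω, Zs i ω))
    (ε := fun N => a N * (2 * (M * B))) ?_ ?_ ?_ ?_ ?_ ?_
    (posSemidef_asymptoticCov hK hKc ?_ hℓ_zero.le) ?_
  · exact fun N i => (hGm N).comp_aemeasurable (h_law i).aemeasurable
  · exact fun N => h_indep.comp (fun _ => G N) fun _ => hGm N
  · intro N i
    have (i : ℕ) : P.map (fun ω => G N (Λ i ω, Zs i ω)) = μ.map (G N) := by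
      rw [← (h_law i).map_eq, AEMeasurable.map_map_of_aemeasurable (hGm N).aemeasurable
        (h_law i).aemeasurable]
      rfl
    rw [this, this]
  · refine Eventually.of_forall fun N => ?_
    rw [hlawG N (u := fun x => x) continuous_id]
    simp only [G]
    rw [integral_smul, integral_sub (hYi N) (integrable_const _)]
    simp
  · simpa using ha.mul_const (2 * (M * B))
  · filter_upwards [hBN] with N hN
    refine ae_of_all _ fun ω => ?_
    simp only [G]
    rw [norm_smul, Real.norm_of_nonneg (ha0 N)]
    refine mul_le_mul_of_nonneg_left ?_ (ha0 N)
    have h1 : ‖∫ q, Y N q ∂μ‖ ≤ M * B := by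
      simpa using norm_integral_le_of_norm_le_const (μ := μ) (ae_of_all _ hN)
    exact (norm_sub_le _ _).trans (by linarith [hN (Λ 0 ω, Zs 0 ω)])
  · exact integral_nonneg fun z => mul_nonneg (hf.nonneg _ _) (sq_nonneg _)
  · intro t
    rw [dotProduct_asymptoticCov_mulVec hK hKc]
    have hJ1 := (tendsto_integral_rescaledScore_pow hK hKc hℓ hℓ_zero.ne' hm1
      (hf.abs_integral_mul_le hM) x₀ t one_ne_zero).comp h_zero
    have hJ2 := (tendsto_integral_rescaledScore_pow hK hKc hℓ hℓ_zero.ne' hm2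
      (hf.abs_integral_mul_le hM2) x₀ t two_ne_zero).comp h_zero
    -- The variance is the second moment minus the squared mean. After normalization the latter
    -- keeps a factor `h ^ d`, which vanishes in the limit because `d ≠ 0`.
    have hlim := (hJ2.sub ((h_zero.pow d).mul (hJ1.pow 2))).const_mul ((ℓ 0)⁻¹ ^ 2)
    rw [zero_pow hd, zero_mul, sub_zero] at hlim
    have hval : (ℓ 0)⁻¹ ^ 2 * (ℓ 0 * (∫ z, f x₀ z * φ z ^ 2) * ∫ l, ⟪gradient K l, t⟫_ℝ ^ 2) =
        (∫ z, f x₀ z * φ z ^ 2) / ℓ 0 * ∫ l, ⟪gradient K l, t⟫_ℝ ^ 2 := by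
      have := hℓ_zero.ne'
      field_simp
    rw [hval] at hlim
    refine hlim.congr' ?_
    filter_upwards [hBN, eventually_ne_atTop 0] with N hN hN0
    have hik (k : ℕ) : Integrable (fun q => ⟪Y N q, t⟫_ℝ ^ k) μ := by
      refine Integrable.of_bound (C := (M * B * ‖t‖) ^ k) ?_ (ae_of_all _ fun q => ?_)
      · have := hYm N
        exact Measurable.aestronglyMeasurable (by fun_prop)
      · rw [norm_pow]
        have : ‖⟪Y N q, t⟫_ℝ‖ ≤ M * B * ‖t‖ :=
          (norm_inner_le_norm _ _).trans (by gcongr; exact hN q)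
        gcongr
    have hf1 := integral_inner_summand_pow hf hℓ.continuous.measurable hℓ0 t 1 (h_pos N) (hik 1)
    have hf2 := integral_inner_summand_pow hf hℓ.continuous.measurable hℓ0 t 2 (h_pos N) (hik 2)
    have hinner : ⟪∫ q, Y N q ∂μ, t⟫_ℝ = ∫ q, ⟪Y N q, t⟫_ℝ ^ 1 ∂μ := by
      simp only [pow_one, real_inner_comm t]
      rw [integral_inner (hYi N) t]
    have hvar : ∫ q, ⟪G N q, t⟫_ℝ ^ 2 ∂μ = a N ^ 2 * (∫ q, ⟪Y N q, t⟫_ℝ ^ 2 ∂μ -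
        (∫ q, ⟪Y N q, t⟫_ℝ ^ 1 ∂μ) ^ 2) := by
      set c := ∫ q, ⟪Y N q, t⟫_ℝ ^ 1 ∂μ with hc
      have hexp (q) : ⟪G N q, t⟫_ℝ ^ 2 =
          a N ^ 2 * (⟪Y N q, t⟫_ℝ ^ 2 - 2 * c * ⟪Y N q, t⟫_ℝ ^ 1 + c ^ 2) := by
        simp only [G, real_inner_smul_left, inner_sub_left, hinner]
        ring
      have hsub : Integrable (fun q => ⟪Y N q, t⟫_ℝ ^ 2 - 2 * c * ⟪Y N q, t⟫_ℝ ^ 1) μ :=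
        (hik 2).sub ((hik 1).const_mul _)
      simp_rw [hexp]
      rw [integral_const_mul, integral_add hsub (integrable_const _),
        integral_sub (hik 2) ((hik 1).const_mul _), integral_const_mul, ← hc]
      simp
      left
      ring
    rw [hlawG N (u := fun x => ⟪x, t⟫_ℝ ^ 2) (by fun_prop), hvar, hf1, hf2, ← mul_assoc, hsq N hN0]
    simp only [Function.comp_apply, pow_one]
    have := (pow_pos (h_pos N) d).ne'
    field_simp

end CentralLimit

/-! ### Regularity and measurability of the weighted gradient -/

section Regularity

variable {d : ℕ}

lemma IterDiff.gradient {k : ℕ} {u : EuclideanSpace ℝ (Fin d) → ℝ} (hu : IterDiff (k + 1) u) :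
    IterDiff k (gradient u) := by
  -- The Riesz isomorphism is conjugate-linear in form; it is repackaged as a linear map over `ℝ`.
  let L : StrongDual ℝ (EuclideanSpace ℝ (Fin d)) →ₗ[ℝ] EuclideanSpace ℝ (Fin d) :=
    { toFun := fun L => (InnerProductSpace.toDual ℝ _).symm L
      map_add' := fun _ _ => map_add _ _ _
      map_smul' := fun c L => by simp }
  exact (iterDiff_succ_iff.1 hu).2.clm_comp
    (L.mkContinuous 1 fun x => by simp [L])

lemma iterDiff_weightedGradient {n p : ℕ} {x₀ : EuclideanSpace ℝ (Fin d)}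
    {ℓ : EuclideanSpace ℝ (Fin d) → ℝ}
    {f : EuclideanSpace ℝ (Fin d) → EuclideanSpace ℝ (Fin n) → ℝ} {z : EuclideanSpace ℝ (Fin n)}
    (hℓ : IterDiff (p + 1) ℓ) (hf : IterDiff (p + 1) fun x => f x z) :
    IterDiff p (weightedGradient x₀ ℓ f z) :=
  ((hℓ.mono p.le_succ).comp_const_sub x₀).bilinear hf.gradient (ContinuousLinearMap.lsmul ℝ ℝ)

/-- A weighted gradient of small oscillation is controlled by the increments of the function. -/
lemma abs_inner_weighted_gradient_le {u w : EuclideanSpace ℝ (Fin d) → ℝ}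
    (hu : Differentiable ℝ u) {x v : EuclideanSpace ℝ (Fin d)} {δ C c : ℝ}
    (hw : ∀ y ∈ Metric.ball x δ, |w y| ≤ c)
    (hC : ∀ y ∈ Metric.ball x δ, ‖w y • gradient u y - w x • gradient u x‖ ≤ C) (hv : ‖v‖ < δ) :
    |⟪w x • gradient u x, v⟫_ℝ| ≤ c * |u (x + v) - u x| + C * ‖v‖ := by
  have hd (t : ℝ) : HasDerivAt (fun s : ℝ => u (x + s • v)) (fderiv ℝ u (x + t • v) v) t := by
    have hl : HasDerivAt (fun s : ℝ => x + s • v) v t := by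
      simpa using ((hasDerivAt_id t).smul_const v).const_add x
    exact (hu (x + t • v)).hasFDerivAt.comp_hasDerivAt t hl
  -- At some intermediate point the derivative along `v` equals the increment `u (x + v) - u x`; the
  -- oscillation bound transfers this to `x`.
  obtain ⟨t, ht, hslope⟩ := exists_hasDerivAt_eq_slope _ _ (zero_lt_one (α := ℝ))
    (fun t _ => (hd t).continuousAt.continuousWithinAt) fun t _ => hd t
  have hy : x + t • v ∈ Metric.ball x δ := by
    rw [mem_ball_iff_norm, add_sub_cancel_left, norm_smul, Real.norm_of_nonneg ht.1.le]
    exact (mul_le_of_le_one_left (norm_nonneg _) ht.2.le).trans_lt hv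
  simp only [one_smul, zero_smul, add_zero, sub_zero, div_one] at hslope
  have h1 : ⟪w (x + t • v) • gradient u (x + t • v), v⟫_ℝ = w (x + t • v) * (u (x + v) - u x) := by
    rw [real_inner_smul_left, inner_gradient, hslope]
  have h2 : |⟪w (x + t • v) • gradient u (x + t • v) - w x • gradient u x, v⟫_ℝ| ≤ C * ‖v‖ :=
    (abs_real_inner_le_norm _ _).trans (mul_le_mul_of_nonneg_right (hC _ hy) (norm_nonneg _))
  rw [inner_sub_left, h1] at h2
  have h3 : |w (x + t • v) * (u (x + v) - u x)| ≤ c * |u (x + v) - u x| := by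
    rw [abs_mul]
    exact mul_le_mul_of_nonneg_right (hw _ hy) (abs_nonneg _)
  rw [abs_le] at *
  constructor <;> linarith [h2.1, h2.2, h3.1, h3.2]

lemma norm_le_sum_abs (x : EuclideanSpace ℝ (Fin d)) : ‖x‖ ≤ ∑ j, |x j| := by
  have : x = ∑ j, EuclideanSpace.single j (x j) := by
    ext i
    simp [Pi.single_apply]
  conv_lhs => rw [this]
  exact (norm_sum_le _ _).trans (by simp)

/-- Each directional derivative is a limit of a sequence of difference quotients, which are
measurable in `z`; finitely many directions determine the derivative. -/
lemma measurable_fderiv_param {n : ℕ}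
    {f : EuclideanSpace ℝ (Fin d) → EuclideanSpace ℝ (Fin n) → ℝ}
    (hf : ∀ x, Measurable (f x)) (hd : ∀ z, Differentiable ℝ fun x => f x z)
    (x : EuclideanSpace ℝ (Fin d)) : Measurable fun z => fderiv ℝ (fun y => f y z) x := by
  have h1 (v : EuclideanSpace ℝ (Fin d)) :
      Measurable fun z => fderiv ℝ (fun y => f y z) x v := by
    refine measurable_of_tendsto_metrizable (f := fun (k : ℕ) z =>
      ((k : ℝ) + 1) * (f (x + ((k : ℝ) + 1)⁻¹ • v) z - f x z)) (fun k => ?_) ?_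
    · exact ((hf _).sub (hf _)).const_mul _
    · refine tendsto_pi_nhds.2 fun z => ?_
      have h2 : HasDerivAt (fun s : ℝ => f (x + s • v) z) (fderiv ℝ (fun y => f y z) x v) 0 := by
        have hl : HasDerivAt (fun s : ℝ => x + s • v) v 0 := by
          simpa using ((hasDerivAt_id (0 : ℝ)).smul_const v).const_add x
        have h3 : HasFDerivAt (fun y => f y z) (fderiv ℝ (fun y => f y z) x) (x + (0 : ℝ) • v) := by
          simpa using (hd z x).hasFDerivAt
        exact h3.comp_hasDerivAt (0 : ℝ) hl
      have h4 := hasDerivAt_iff_tendsto_slope_zero.1 h2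
      have h5 : Tendsto (fun k : ℕ => ((k : ℝ) + 1)⁻¹) atTop (𝓝[≠] 0) := by
        refine tendsto_nhdsWithin_iff.2 ⟨?_, Eventually.of_forall fun k => by
          simp only [Set.mem_compl_iff, Set.mem_singleton_iff]; positivity⟩
        simpa using tendsto_one_div_add_atTop_nhds_zero_nat (𝕜 := ℝ)
      simpa [Function.comp_def] using h4.comp h5
  have h2 : (fun z => fderiv ℝ (fun y => f y z) x) = fun z => ∑ j,
      fderiv ℝ (fun y => f y z) x (EuclideanSpace.single j 1) •
        (EuclideanSpace.proj j : EuclideanSpace ℝ (Fin d) →L[ℝ] ℝ) := by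
    funext z
    ext v
    have hv : v = ∑ j, v j • EuclideanSpace.single j (1 : ℝ) := by
      ext i
      simp [Pi.single_apply]
    conv_lhs => rw [hv]
    simp [mul_comm]
  rw [h2]
  exact Finset.measurable_fun_sum _ fun j _ => (h1 _).smul_const _

end Regularity

/-! ### Integrable domination and integration by parts -/

section Bias

variable {d n p : ℕ} {K ℓ : EuclideanSpace ℝ (Fin d) → ℝ}
  {f : EuclideanSpace ℝ (Fin d) → EuclideanSpace ℝ (Fin n) → ℝ}
  {φ G : EuclideanSpace ℝ (Fin n) → ℝ} {x₀ : EuclideanSpace ℝ (Fin d)} {M δ : ℝ}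

/-- Integrable domination near `x₀` of the weighted gradient and of its derivative of order `p`,
from the domination of the oscillations of its derivatives. -/
lemma exists_integrable_bound (hp : 2 ≤ p) (hf : IsDensityFamily f)
    (hfd : ∀ z, IterDiff (p + 1) fun x => f x z) (hℓ : IterDiff (p + 1) ℓ) (hℓ_zero : 0 < ℓ 0)
    (hφ : Measurable φ) (hM : ∀ z, |φ z| ≤ M) (hG : Integrable G) (hδ : 0 < δ)
    (hosc : ∀ᵐ z, ∀ i ≤ p, ∀ x ∈ Metric.ball x₀ δ,
      |φ z| * ‖iteratedFDeriv ℝ i (weightedGradient x₀ ℓ f z) x -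
        iteratedFDeriv ℝ i (weightedGradient x₀ ℓ f z) x₀‖ ≤ G z) :
    ∃ H : EuclideanSpace ℝ (Fin n) → ℝ, Integrable H ∧ ∃ r > 0,
      (∀ x ∈ Metric.ball x₀ r, ℓ 0 / 2 ≤ ℓ (x₀ - x)) ∧
      ∀ᵐ z, ∀ x ∈ Metric.ball x₀ r, |φ z| * ‖weightedGradient x₀ ℓ f z x‖ ≤ H z ∧
        |φ z| * ‖iteratedFDeriv ℝ p (weightedGradient x₀ ℓ f z) x‖ ≤ H z := by
  have hℓc : Continuous ℓ := (iterDiff_succ_iff.1 hℓ).1.continuous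
  have hloc : ∀ᶠ x in 𝓝 x₀, ℓ 0 / 2 < ℓ (x₀ - x) ∧ |ℓ (x₀ - x)| < |ℓ 0| + 1 := by
    have h1 : Tendsto (fun x => ℓ (x₀ - x)) (𝓝 x₀) (𝓝 (ℓ 0)) := by
      simpa using (by fun_prop : Continuous fun x => ℓ (x₀ - x)).tendsto x₀
    exact (h1.eventually_const_lt (half_lt_self hℓ_zero)).and
      (h1.abs.eventually_lt_const (lt_add_one _))
  obtain ⟨δ', hδ', hball⟩ := Metric.eventually_nhds_iff_ball.1 hloc
  set r := min δ δ'
  have hr : 0 < r := lt_min hδ hδ'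
  set c := |ℓ 0| + 1
  set e : Fin d → EuclideanSpace ℝ (Fin d) := fun j => EuclideanSpace.single j (r / 2)
  -- `H₀` bounds the weighted gradient at `x₀` coordinate by coordinate, through increments of `f`
  -- along `e j`; the length `r / 2` keeps `x₀ + e j` in the ball. `H₁` is the bound of the
  -- derivative of order `p` by oscillations.
  set H₀ : EuclideanSpace ℝ (Fin n) → ℝ := fun z =>
    ∑ j, (r / 2)⁻¹ * (c * (|f (x₀ + e j) z * φ z| + |f x₀ z * φ z|) + G z * (r / 2))
  set H₁ : EuclideanSpace ℝ (Fin n) → ℝ := fun z => 2 * (1 + r⁻¹) * G z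
  have hH₀ : Integrable H₀ := by
    refine integrable_finsetSum _ fun j _ => (Integrable.add (Integrable.const_mul ?_ _)
      (hG.mul_const _)).const_mul _
    exact (hf.integrable_mul hφ hM _).abs.add (hf.integrable_mul hφ hM _).abs
  have hH₁ : Integrable H₁ := hG.const_mul _
  refine ⟨fun z => (H₀ z + G z) + H₁ z, (hH₀.add hG).add hH₁, r, hr,
    fun x hx => (hball x (Metric.ball_subset_ball (min_le_right _ _) hx)).1.le, ?_⟩
  filter_upwards [hosc] with z hz
  have hx₀ : x₀ ∈ Metric.ball x₀ r := Metric.mem_ball_self hr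
  have hsub : ∀ x ∈ Metric.ball x₀ r, x ∈ Metric.ball x₀ δ :=
    fun x hx => Metric.ball_subset_ball (min_le_left _ _) hx
  have hG0 : 0 ≤ G z := le_trans (by positivity) (hz 0 (Nat.zero_le _) x₀ (hsub _ hx₀))
  have hH₀0 : 0 ≤ H₀ z := Finset.sum_nonneg fun j _ => by positivity
  have hH₁0 : 0 ≤ H₁ z := by positivity
  by_cases hφz : φ z = 0
  · intro x _
    simp only [hφz, abs_zero, zero_mul]
    constructor <;> positivity
  have hφ0 : 0 < |φ z| := abs_pos.2 hφz
  set g := weightedGradient x₀ ℓ f z with hg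
  have hgd : IterDiff p g := iterDiff_weightedGradient hℓ (hfd z)
  have hosc' (i : ℕ) (hi : i ≤ p) : ∀ x ∈ Metric.ball x₀ r,
      ‖iteratedFDeriv ℝ i g x - iteratedFDeriv ℝ i g x₀‖ ≤ G z / |φ z| := fun x hx => by
    rw [le_div_iff₀' hφ0]
    exact hz i hi x (hsub x hx)
  have hosc0 : ∀ x ∈ Metric.ball x₀ r, ‖g x - g x₀‖ ≤ G z / |φ z| := fun x hx => by
    have := hosc' 0 (Nat.zero_le _) x hx
    simp only [iteratedFDeriv_zero_eq_comp, Function.comp_apply] at this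
    rwa [← dist_eq_norm, LinearIsometryEquiv.dist_map, dist_eq_norm] at this
  have hg0 : |φ z| * ‖g x₀‖ ≤ H₀ z := by
    refine (mul_le_mul_of_nonneg_left (norm_le_sum_abs _) hφ0.le).trans ?_
    rw [Finset.mul_sum]
    refine Finset.sum_le_sum fun j _ => ?_
    have hej : ‖e j‖ = r / 2 := by
      simp [e, abs_of_pos hr]
    have h1 := abs_inner_weighted_gradient_le (u := fun x => f x z) (w := fun x => ℓ (x₀ - x))
      (iterDiff_succ_iff.1 (hfd z)).1 (x := x₀) (v := e j) (δ := r) (c := c)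
      (fun y hy => (hball y (Metric.ball_subset_ball (min_le_right _ _) hy)).2.le) hosc0
      (by rw [hej]; linarith)
    have h2 : ⟪g x₀, e j⟫_ℝ = (r / 2) * g x₀ j := by
      simp [e, PiLp.inner_apply]
    change |⟪g x₀, e j⟫_ℝ| ≤ _ at h1
    rw [h2, hej, abs_mul, abs_of_pos (half_pos hr)] at h1
    have h3 : |f (x₀ + e j) z - f x₀ z| ≤ |f (x₀ + e j) z| + |f x₀ z| := abs_sub _ _
    have hc : 0 ≤ c := by positivity
    rw [le_inv_mul_iff₀ (half_pos hr), abs_mul, abs_mul]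
    calc r / 2 * (|φ z| * |g x₀ j|) = |φ z| * (r / 2 * |g x₀ j|) := by ring
      _ ≤ |φ z| * (c * (|f (x₀ + e j) z| + |f x₀ z|) + G z / |φ z| * (r / 2)) := by
          refine mul_le_mul_of_nonneg_left (h1.trans ?_) hφ0.le
          gcongr
      _ = _ := by field_simp
  obtain ⟨q, rfl⟩ : ∃ q, p = q + 1 := ⟨p - 1, by omega⟩
  have hgp := norm_iteratedFDeriv_le_of_oscillation hgd hr (hosc' q q.le_succ) (hosc' (q + 1) le_rfl)
  intro x hx
  constructor
  · have h1 : ‖g x‖ ≤ ‖g x₀‖ + G z / |φ z| :=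
      (norm_le_insert' _ (g x₀)).trans (add_le_add_right (hosc0 x hx) _)
    calc |φ z| * ‖g x‖ ≤ |φ z| * (‖g x₀‖ + G z / |φ z|) := by gcongr
      _ = |φ z| * ‖g x₀‖ + G z := by field_simp
      _ ≤ _ := by linarith
  · calc |φ z| * ‖iteratedFDeriv ℝ (q + 1) g x‖ ≤ |φ z| * (2 * (1 + r⁻¹) * (G z / |φ z|)) := by
          gcongr
          exact hgp x hx
      _ = H₁ z := by
          simp only [H₁]
          field_simp
      _ ≤ _ := by linarith

/-- Differentiation under the expectation. -/
lemma hasFDerivAt_integral_density (hf : IsDensityFamily f)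
    (hfd : ∀ z, Differentiable ℝ fun x => f x z) (hℓ_zero : 0 < ℓ 0)
    (hφ : Measurable φ) (hM : ∀ z, |φ z| ≤ M) {H : EuclideanSpace ℝ (Fin n) → ℝ}
    (hH : Integrable H) {r : ℝ} (hr : 0 < r) (hℓr : ∀ x ∈ Metric.ball x₀ r, ℓ 0 / 2 ≤ ℓ (x₀ - x))
    (hb : ∀ᵐ z, ∀ x ∈ Metric.ball x₀ r, |φ z| * ‖weightedGradient x₀ ℓ f z x‖ ≤ H z) :
    HasFDerivAt (fun x => ∫ z, f x z * φ z) (∫ z, φ z • fderiv ℝ (fun x => f x z) x₀) x₀ ∧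
      Integrable fun z => φ z • fderiv ℝ (fun x => f x z) x₀ := by
  have hmeas : AEStronglyMeasurable (fun z => φ z • fderiv ℝ (fun x => f x z) x₀) :=
    (hφ.smul (measurable_fderiv_param hf.measurable hfd x₀)).aestronglyMeasurable
  have hbound : ∀ᵐ z, ∀ x ∈ Metric.ball x₀ r,
      ‖φ z • fderiv ℝ (fun x => f x z) x‖ ≤ (ℓ 0 / 2)⁻¹ * H z := by
    filter_upwards [hb] with z hz x hx
    have h1 := hz x hx
    have h2 : 0 < ℓ 0 / 2 := half_pos hℓ_zero
    have h3 := hℓr x hx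
    rw [weightedGradient, norm_smul, gradient, LinearIsometryEquiv.norm_map, Real.norm_eq_abs,
      abs_of_pos (h2.trans_le h3)] at h1
    rw [norm_smul, Real.norm_eq_abs, le_inv_mul_iff₀ h2]
    refine le_trans ?_ h1
    rw [mul_left_comm]
    gcongr
  refine ⟨hasFDerivAt_integral_of_dominated_of_fderiv_le (F := fun x z => f x z * φ z)
    (F' := fun x z => φ z • fderiv ℝ (fun x => f x z) x)
    (Metric.ball_mem_nhds x₀ hr) ?_ (hf.integrable_mul hφ hM x₀) hmeas hbound (hH.const_mul _) ?_, ?_⟩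
  · exact Eventually.of_forall fun x => (hf.integrable_mul hφ hM x).aestronglyMeasurable
  · exact ae_of_all _ fun z x _ => (hfd z x).hasFDerivAt.mul_const (φ z)
  · refine (hH.const_mul (ℓ 0 / 2)⁻¹).mono' hmeas ?_
    filter_upwards [hbound] with z hz using hz x₀ (Metric.mem_ball_self hr)

/-- Integration by parts in the mean of the estimator, for a fixed sample point `z`. -/
lemma integral_mul_inner_rescaledScore (hK : ContDiff ℝ 1 K) (hKc : HasCompactSupport K)
    (hℓ : ContDiff ℝ 1 ℓ) (hℓ0 : ∀ x, 0 ≤ ℓ x) {z : EuclideanSpace ℝ (Fin n)}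
    (hf : ContDiff ℝ 1 fun x => f x z) (h : ℝ) (t : EuclideanSpace ℝ (Fin d)) :
    ∫ l, ℓ (h • l) * f (x₀ - h • l) z * ⟪rescaledScore K ℓ h l, t⟫_ℝ =
      h * ∫ l, K l * ⟪weightedGradient x₀ ℓ f z (x₀ - h • l), t⟫_ℝ := by
  set b : EuclideanSpace ℝ (Fin d) → ℝ := fun l => ℓ (h • l) * f (x₀ - h • l) z with hb
  have hb1 : ContDiff ℝ 1 b := by
    have h1 : ContDiff ℝ 1 fun l : EuclideanSpace ℝ (Fin d) => h • l := by fun_prop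
    exact (hℓ.comp h1).mul (hf.comp (contDiff_const.sub h1))
  -- The two terms have opposite signs because `ℓ` is taken at `h • l` and `f` at `x₀ - h • l`.
  -- After integration by parts the term in `∇ℓ` cancels against the correction in the score.
  have hbd (l : EuclideanSpace ℝ (Fin d)) : fderiv ℝ b l t =
      h * (fderiv ℝ ℓ (h • l) t * f (x₀ - h • l) z) -
        h * ⟪weightedGradient x₀ ℓ f z (x₀ - h • l), t⟫_ℝ := by
    have h1 : HasFDerivAt (fun l : EuclideanSpace ℝ (Fin d) => h • l)
        (h • ContinuousLinearMap.id ℝ _) l := (hasFDerivAt_id l).const_smul h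
    have h2 := ((hℓ.differentiable one_ne_zero (h • l)).hasFDerivAt.comp l h1)
    have h3 := ((hf.differentiable one_ne_zero (x₀ - h • l)).hasFDerivAt.comp l (h1.const_sub x₀))
    have h4 := (h2.mul h3).fderiv
    rw [show fderiv ℝ b l = _ from h4]
    simp only [weightedGradient, real_inner_smul_left, inner_gradient, sub_sub_cancel]
    simp
    ring
  have hcs (u : EuclideanSpace ℝ (Fin d) → ℝ) (hu : Continuous u) : Integrable fun l => K l * u l :=
    (hK.continuous.mul hu).integrable_of_hasCompactSupport hKc.mul_right
  have hb' : Continuous fun l => fderiv ℝ b l t :=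
    (hb1.continuous_fderiv one_ne_zero).clm_apply continuous_const
  have hK' : Continuous fun l => fderiv ℝ K l t :=
    (hK.continuous_fderiv one_ne_zero).clm_apply continuous_const
  have hi1 : Integrable fun l => fderiv ℝ K l t * b l := by
    refine (hK'.mul hb1.continuous).integrable_of_hasCompactSupport ?_
    refine HasCompactSupport.intro hKc fun x hx => ?_
    simp [fderiv_of_notMem_tsupport ℝ hx]
  have hibp := integral_mul_fderiv_eq_neg_fderiv_mul_of_integrable (μ := volume) (f := K) (g := b)
    (v := t) hi1 (hcs _ hb') (hcs _ hb1.continuous)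
    (fun x _ => hK.differentiable one_ne_zero x) fun x _ => hb1.differentiable one_ne_zero x
  have hpt (l : EuclideanSpace ℝ (Fin d)) :
      ℓ (h • l) * f (x₀ - h • l) z * ⟪rescaledScore K ℓ h l, t⟫_ℝ =
        fderiv ℝ K l t * b l + K l * (h * (fderiv ℝ ℓ (h • l) t * f (x₀ - h • l) z)) := by
    have h1 := congrArg (fun v => ⟪v, t⟫_ℝ) (smul_rescaledScore (K := K) hℓ0 h l)
    simp only [inner_add_left, real_inner_smul_left, inner_gradient] at h1
    rw [mul_right_comm, h1]
    ring
  have hi2 : Integrable fun l => K l * (h * (fderiv ℝ ℓ (h • l) t * f (x₀ - h • l) z)) := by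
    have h1 := hℓ.continuous_fderiv one_ne_zero
    have h2 := hf.continuous
    exact hcs _ (continuous_const.mul (((h1.comp (by fun_prop)).clm_apply continuous_const).mul
      (h2.comp (by fun_prop : Continuous fun l : EuclideanSpace ℝ (Fin d) => x₀ - h • l))))
  simp_rw [hpt]
  rw [integral_add hi1 hi2, ← neg_neg (∫ l, fderiv ℝ K l t * b l), ← hibp, ← integral_const_mul,
    neg_add_eq_sub, ← integral_sub hi2 (hcs _ hb')]
  congr 1 with l
  rw [hbd]
  ring

end Bias

/-! ### Mean and bias of the estimator -/

section Mean

variable {d n p : ℕ} {K ℓ : EuclideanSpace ℝ (Fin d) → ℝ}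
  {f : EuclideanSpace ℝ (Fin d) → EuclideanSpace ℝ (Fin n) → ℝ}
  {φ G : EuclideanSpace ℝ (Fin n) → ℝ} {x₀ : EuclideanSpace ℝ (Fin d)} {M δ : ℝ}

/-- The mean of a summand of the estimator, after integration by parts. -/
lemma inner_integral_summand (hf : IsDensityFamily f) (hfd : ∀ z, ContDiff ℝ 1 fun x => f x z)
    (hK : ContDiff ℝ 1 K) (hKc : HasCompactSupport K) (hℓ : ContDiff ℝ 1 ℓ) (hℓ0 : ∀ x, 0 ≤ ℓ x)
    (hφ : Measurable φ) (hM : ∀ z, |φ z| ≤ M) {h : ℝ} (hh : 0 < h)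
    (t : EuclideanSpace ℝ (Fin d)) :
    (Integrable fun z => φ z * ∫ l, K l * ⟪weightedGradient x₀ ℓ f z (x₀ - h • l), t⟫_ℝ) ∧
      ⟪∫ q, summand K ℓ φ x₀ h q ∂(randomizedLaw x₀ ℓ f), t⟫_ℝ = h ^ (d + 1) *
        ∫ z, φ z * ∫ l, K l * ⟪weightedGradient x₀ ℓ f z (x₀ - h • l), t⟫_ℝ := by
  have hi := integrable_summand (x₀ := x₀) hf hK hKc hℓ hℓ0 hφ hM hh.ne'
  have hit : Integrable (fun q => ⟪t, summand K ℓ φ x₀ h q⟫_ℝ) (randomizedLaw x₀ ℓ f) :=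
    hi.const_inner t
  have hin := integral_inner (𝕜 := ℝ) hi t
  rw [integrable_randomizedLaw_iff hf hℓ.continuous.measurable hℓ0, Measure.volume_eq_prod] at hit
  -- Fubini is applied with `x` as the inner variable, since the integration by parts takes place at
  -- fixed `z`.
  rw [real_inner_comm, ← hin, integral_randomizedLaw hf hℓ.continuous.measurable hℓ0,
    Measure.volume_eq_prod, integral_prod_symm _ hit]
  have hz (z : EuclideanSpace ℝ (Fin n)) :
      ∫ x, (ℓ (x₀ - x) * f x z) • ⟪t, summand K ℓ φ x₀ h (x, z)⟫_ℝ =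
        h ^ (d + 1) * (φ z * ∫ l, K l * ⟪weightedGradient x₀ ℓ f z (x₀ - h • l), t⟫_ℝ) := by
    have h1 := integral_comp_rescale (fun l => φ z * (ℓ (h • l) * f (x₀ - h • l) z *
      ⟪rescaledScore K ℓ h l, t⟫_ℝ)) x₀ hh
    rw [integral_const_mul (φ z) fun l => ℓ (h • l) * f (x₀ - h • l) z *
      ⟪rescaledScore K ℓ h l, t⟫_ℝ, integral_mul_inner_rescaledScore hK hKc hℓ hℓ0 (hfd z)] at h1
    refine Eq.trans ?_ (h1.trans ?_)
    · congr 1 with x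
      simp only [smul_inv_smul₀ hh.ne', sub_sub_cancel, summand, real_inner_smul_right, smul_eq_mul,
        real_inner_comm t]
      ring
    · rw [smul_eq_mul]
      ring
  constructor
  · have h1 := hit.integral_prod_right
    simp only [hz] at h1
    have h2 := h1.const_mul (h ^ (d + 1))⁻¹
    simpa only [inv_mul_cancel_left₀ (pow_pos hh (d + 1)).ne'] using h2
  · simp only [hz]
    rw [integral_const_mul]

variable {Ω : Type*} [MeasurableSpace Ω] {P : Measure Ω}
  {Λ : ℕ → Ω → EuclideanSpace ℝ (Fin d)} {Zs : ℕ → Ω → EuclideanSpace ℝ (Fin n)}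

/-- The bias of the estimator is of the order of the kernel. -/
theorem exists_norm_integral_betaHat_sub_gradient_le (hf : IsDensityFamily f)
    (hfd : ∀ z, IterDiff (p + 1) fun x => f x z) (hK : AssumptionK K p) (hℓ : IterDiff (p + 1) ℓ)
    (hℓ0 : ∀ x, 0 ≤ ℓ x) (hℓ_zero : 0 < ℓ 0) (hφ : Measurable φ) (hM : ∀ z, |φ z| ≤ M)
    (hG : Integrable G) (hδ : 0 < δ)
    (hosc : ∀ᵐ z, ∀ i ≤ p, ∀ x ∈ Metric.ball x₀ δ,
      |φ z| * ‖iteratedFDeriv ℝ i (weightedGradient x₀ ℓ f z) x -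
        iteratedFDeriv ℝ i (weightedGradient x₀ ℓ f z) x₀‖ ≤ G z)
    (h_law : ∀ i, HasLaw (fun ω => (Λ i ω, Zs i ω)) (randomizedLaw x₀ ℓ f) P) :
    DifferentiableAt ℝ (fun x => ∫ z, f x z * φ z) x₀ ∧
    ∃ C, ∃ η > 0, ∀ h, 0 < h → h < η → ∀ N : ℕ, N ≠ 0 →
      ‖(∫ ω, betaHat K ℓ φ x₀ N h (fun i => Λ i ω) (fun i => Zs i ω) ∂P) -
        gradient (fun x => ∫ z, f x z * φ z) x₀‖ ≤ C * h ^ p := by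
  have hp := hK.two_le
  have hC1 {u : EuclideanSpace ℝ (Fin d) → ℝ} (hu : IterDiff (p + 1) u) : ContDiff ℝ 1 u :=
    hu.contDiff.of_le (by exact_mod_cast (by omega : 1 ≤ p))
  have hℓ1 := hC1 hℓ
  have hf1 := fun z => hC1 (hfd z)
  obtain ⟨H, hH, r, hr, hℓr, hb⟩ := exists_integrable_bound hp hf hfd hℓ hℓ_zero hφ hM hG hδ hosc
  obtain ⟨hV, hVi⟩ := hasFDerivAt_integral_density hf (fun z => (hf1 z).differentiable one_ne_zero)
    hℓ_zero hφ hM hH hr hℓr (hb.mono fun z hz x hx => (hz x hx).1)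
  refine ⟨hV.differentiableAt, ?_⟩
  obtain ⟨R, hR0, hR⟩ := hK.compact.isCompact.isBounded.exists_pos_norm_le
  have hR' : ∀ l, K l ≠ 0 → ‖l‖ ≤ R := fun l hl => hR l (subset_tsupport K hl)
  -- For `h < r / R` the points `x₀ - h • l`, with `l` in the support of `K`, lie in the ball where
  -- `H` dominates. The factor `R ^ p` comes from the Taylor remainder `(h * R) ^ p`.
  refine ⟨(ℓ 0)⁻¹ * ((∫ l, |K l|) * (∫ z, H z) * R ^ p), r / R, div_pos hr hR0,
    fun h hh hhr N hN => ?_⟩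
  have hhR : h * R < r := (lt_div_iff₀ hR0).1 hhr
  set g := weightedGradient x₀ ℓ f with hg
  set b := (∫ ω, betaHat K ℓ φ x₀ N h (fun i => Λ i ω) (fun i => Zs i ω) ∂P) -
        gradient (fun x => ∫ z, f x z * φ z) x₀ with hbdef
  have hgz (z : EuclideanSpace ℝ (Fin n)) : IterDiff p (g z) := iterDiff_weightedGradient hℓ (hfd z)
  have hgc (z : EuclideanSpace ℝ (Fin n)) : Continuous (g z) :=
    (iterDiff_succ_iff.1 ((hgz z).mono (by omega : 0 + 1 ≤ p))).1.continuous
  have hN' : (N : ℝ) ≠ 0 := Nat.cast_ne_zero.2 hN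
  -- The norm of the bias `b` is estimated by duality: `b` is tested against every `t`, then `t = b`
  -- is chosen.
  have key (t : EuclideanSpace ℝ (Fin d)) :
      |⟪b, t⟫_ℝ| ≤ (ℓ 0)⁻¹ * ((∫ l, |K l|) * (∫ z, H z) * R ^ p) * h ^ p * ‖t‖ := by
    obtain ⟨hi, hmean⟩ := inner_integral_summand (x₀ := x₀) hf hf1 hK.contDiff hK.compact hℓ1 hℓ0
      hφ hM hh t
    have hV' : ⟪gradient (fun x => ∫ z, f x z * φ z) x₀, t⟫_ℝ =
        ∫ z, (ℓ 0)⁻¹ * (φ z * ⟪g z x₀, t⟫_ℝ) := by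
      rw [inner_gradient, hV.fderiv, ContinuousLinearMap.integral_apply hVi]
      congr 1 with z
      simp only [hg, weightedGradient, real_inner_smul_left, inner_gradient, sub_self,
        _root_.smul_apply, smul_eq_mul]
      field_simp
    have hVint : Integrable fun z => (ℓ 0)⁻¹ * (φ z * ⟪g z x₀, t⟫_ℝ) := by
      refine (hVi.apply_continuousLinearMap t).congr (ae_of_all _ fun z => ?_)
      simp only [hg, weightedGradient, real_inner_smul_left, inner_gradient, sub_self,
        _root_.smul_apply, smul_eq_mul]
      field_simp
    have hdiff (z : EuclideanSpace ℝ (Fin n)) :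
        (ℓ 0)⁻¹ * (φ z * ∫ l, K l * ⟪g z (x₀ - h • l), t⟫_ℝ) - (ℓ 0)⁻¹ * (φ z * ⟪g z x₀, t⟫_ℝ) =
          (ℓ 0)⁻¹ * (φ z * ⟪(∫ l, K l • g z (x₀ - h • l)) - g z x₀, t⟫_ℝ) := by
      have hint : Integrable fun l => K l • g z (x₀ - h • l) :=
        (hK.contDiff.continuous.smul ((hgc z).comp (by fun_prop))).integrable_of_hasCompactSupport
          hK.compact.smul_right
      have := integral_inner (𝕜 := ℝ) hint t
      rw [inner_sub_left, real_inner_comm t (∫ l, K l • g z (x₀ - h • l)), ← this]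
      simp only [real_inner_smul_right, real_inner_comm t]
      ring
    have hbt : ⟪b, t⟫_ℝ =
        ∫ z, (ℓ 0)⁻¹ * (φ z * ⟪(∫ l, K l • g z (x₀ - h • l)) - g z x₀, t⟫_ℝ) := by
      simp_rw [← hdiff]
      rw [integral_sub (hi.const_mul _) hVint, integral_const_mul, hbdef, inner_sub_left, hV',
        integral_betaHat hf hK.contDiff hK.compact hℓ1 hℓ0 hφ hM h_law hh, real_inner_smul_left,
        hmean]
      congr 1
      have := (pow_pos hh (d + 1)).ne'
      have := hℓ_zero.ne'
      field_simp
    rw [hbt]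
    have hbound : ∀ᵐ z, ‖(ℓ 0)⁻¹ * (φ z * ⟪(∫ l, K l • g z (x₀ - h • l)) - g z x₀, t⟫_ℝ)‖ ≤
        (ℓ 0)⁻¹ * ((∫ l, |K l|) * (h * R) ^ p * ‖t‖) * H z := by
      filter_upwards [hb] with z hz
      rw [norm_mul, Real.norm_of_nonneg (inv_pos.2 hℓ_zero).le, mul_assoc]
      refine mul_le_mul_of_nonneg_left ?_ (inv_pos.2 hℓ_zero).le
      rw [norm_mul, Real.norm_eq_abs (φ z)]
      by_cases hφz : φ z = 0
      · have := (mul_nonneg (abs_nonneg _) (norm_nonneg _)).trans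
          (hz x₀ (Metric.mem_ball_self hr)).1
        have : 0 ≤ ∫ l, |K l| := integral_nonneg fun _ => abs_nonneg _
        simp only [hφz, abs_zero, zero_mul]
        positivity
      have hφ0 : 0 < |φ z| := abs_pos.2 hφz
      have h1 := hK.norm_integral_smul_sub_le hR' (hgz z) hh hhR (C := H z / |φ z|)
        fun y hy => by
          rw [le_div_iff₀' hφ0]
          exact (hz y hy).2
      have h2 := (norm_inner_le_norm (𝕜 := ℝ) ((∫ l, K l • g z (x₀ - h • l)) - g z x₀) t).trans
        (mul_le_mul_of_nonneg_right h1 (norm_nonneg t))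
      refine (mul_le_mul_of_nonneg_left h2 hφ0.le).trans (le_of_eq ?_)
      field_simp
    have := norm_integral_le_of_norm_le (hH.const_mul _) hbound
    rw [integral_const_mul _ H, Real.norm_eq_abs] at this
    refine this.trans (le_of_eq ?_)
    rw [mul_pow]
    ring
  have h1 := key b
  rw [real_inner_self_eq_norm_mul_norm, abs_of_nonneg (by positivity)] at h1
  rcases (norm_nonneg b).eq_or_lt with h0 | h0
  · rw [← h0]
    have : 0 ≤ ∫ l, |K l| := integral_nonneg fun _ => abs_nonneg _
    have : 0 ≤ ∫ z, H z := integral_nonneg_of_ae (hb.mono fun z hz =>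
      (mul_nonneg (abs_nonneg _) (norm_nonneg _)).trans (hz x₀ (Metric.mem_ball_self hr)).1)
    positivity
  · exact le_of_mul_le_mul_right h1 h0

end Mean

/-! ### From random vectors and essentially bounded payoffs to densities and bounded functions -/

section Reduction

variable {d n : ℕ} {Ω : Type*} [MeasurableSpace Ω] {P : Measure Ω}
  {f : EuclideanSpace ℝ (Fin d) → EuclideanSpace ℝ (Fin n) → ℝ}

lemma isDensityFamily_of_hasLaw [IsProbabilityMeasure P] (hc : ∀ z, Continuous fun x => f x z)
    (hm : ∀ x, Measurable (f x)) (h0 : ∀ x z, 0 ≤ f x z)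
    {Z : EuclideanSpace ℝ (Fin d) → Ω → EuclideanSpace ℝ (Fin n)}
    (hZ : ∀ x, HasLaw (Z x) (volume.withDensity fun z => ENNReal.ofReal (f x z)) P) :
    IsDensityFamily f := by
  have h1 (x) : ∫⁻ z, ENNReal.ofReal (f x z) = 1 := by
    have hP : IsProbabilityMeasure (volume.withDensity fun z => ENNReal.ofReal (f x z)) :=
      (hZ x).isProbabilityMeasure_iff.1 inferInstance
    rw [← hP.measure_univ, withDensity_apply _ MeasurableSet.univ, setLIntegral_univ]
  have hi (x) : Integrable (f x) := by
    refine ⟨(hm x).aestronglyMeasurable, ?_⟩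
    rw [hasFiniteIntegral_iff_ofReal (ae_of_all _ (h0 x)), h1]
    exact ENNReal.one_lt_top
  refine ⟨hc, hm, h0, hi, fun x => ?_⟩
  rw [integral_eq_lintegral_of_nonneg_ae (ae_of_all _ (h0 x)) (hm x).aestronglyMeasurable, h1]
  simp

lemma integral_comp_hasLaw {u : EuclideanSpace ℝ (Fin n) → ℝ} (hu : Measurable u)
    (h0 : ∀ z, 0 ≤ u z) {Z : Ω → EuclideanSpace ℝ (Fin n)}
    (hZ : HasLaw Z (volume.withDensity fun z => ENNReal.ofReal (u z)) P)
    {φ : EuclideanSpace ℝ (Fin n) → ℝ} (hφ : AEStronglyMeasurable φ) :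
    ∫ ω, φ (Z ω) ∂P = ∫ z, u z * φ z := by
  have h1 := hZ.integral_comp (hφ.mono_ac (withDensity_absolutelyContinuous _ _))
  rw [integral_withDensity_eq_integral_toReal_smul hu.ennreal_ofReal (by simp)] at h1
  simpa only [Function.comp_def, ENNReal.toReal_ofReal (h0 _), smul_eq_mul] using h1

/-- An essentially bounded function has a measurable version which is bounded everywhere. -/
lemma exists_measurable_bounded_ae_eq {φ : EuclideanSpace ℝ (Fin n) → ℝ} (hφ : MemLp φ ⊤ volume) :
    ∃ ψ : EuclideanSpace ℝ (Fin n) → ℝ, Measurable ψ ∧ (∃ M, ∀ z, |ψ z| ≤ M) ∧ φ =ᵐ[volume] ψ := by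
  obtain ⟨M, hM⟩ : ∃ M : ℝ, ∀ᵐ z, |φ z| ≤ M := by
    have hlt : eLpNormEssSup φ volume < ⊤ := by simpa using hφ.2
    refine ⟨(eLpNormEssSup φ volume).toReal, ?_⟩
    filter_upwards [ae_le_eLpNormEssSup (f := φ) (μ := volume)] with z hz
    have := ENNReal.toReal_mono hlt.ne hz
    simpa using this
  have hm := hφ.1.aemeasurable
  -- A measurable version is truncated at `|M|` rather than `M`, so that the bounds are in the right
  -- order whatever the sign of `M`.
  refine ⟨fun z => max (-|M|) (min (hm.mk φ z) |M|), ?_, ⟨|M|, fun z => ?_⟩, ?_⟩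
  · exact measurable_const.max (hm.measurable_mk.min measurable_const)
  · exact abs_le.2 ⟨le_max_left _ _, max_le (by linarith [abs_nonneg M]) (min_le_right _ _)⟩
  · filter_upwards [hm.ae_eq_mk, hM] with z hz hzM
    have := abs_le.1 (hzM.trans (le_abs_self M))
    rw [← hz, min_eq_left this.2, max_eq_right this.1]

lemma ae_comp_eq_of_hasLaw_randomizedLaw {x₀ : EuclideanSpace ℝ (Fin d)}
    {ℓ : EuclideanSpace ℝ (Fin d) → ℝ} {Λ : Ω → EuclideanSpace ℝ (Fin d)}
    {Z : Ω → EuclideanSpace ℝ (Fin n)}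
    (h : HasLaw (fun ω => (Λ ω, Z ω)) (randomizedLaw x₀ ℓ f) P)
    {φ ψ : EuclideanSpace ℝ (Fin n) → ℝ} (hφψ : φ =ᵐ[volume] ψ) :
    ∀ᵐ ω ∂P, φ (Z ω) = ψ (Z ω) := by
  have h1 : ∀ᵐ q : EuclideanSpace ℝ (Fin d) × EuclideanSpace ℝ (Fin n), φ q.2 = ψ q.2 := by
    rw [Measure.volume_eq_prod]
    exact Measure.quasiMeasurePreserving_snd.ae hφψ
  have h2 : ∀ᵐ q ∂(randomizedLaw x₀ ℓ f), φ q.2 = ψ q.2 :=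
    (withDensity_absolutelyContinuous _ _).ae_le h1
  rw [← h.map_eq] at h2
  exact ae_of_ae_map h.aemeasurable h2

end Reduction

end KernelGreeks

end

/-! ### Proof of the theorem -/

theorem theorem4p1 {d n p : ℕ} {Ω : Type*} [MeasurableSpace Ω] (P : Measure Ω)
    [IsProbabilityMeasure P]
    (x₀ : EuclideanSpace ℝ (Fin d))
    -- the densities `f(x, ·)` of the random vectors `Z(x)`
    (f : EuclideanSpace ℝ (Fin d) → EuclideanSpace ℝ (Fin n) → ℝ)
    (hf_meas : ∀ x, Measurable (f x)) (hf_nonneg : ∀ x z, 0 ≤ f x z)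
    (Z : EuclideanSpace ℝ (Fin d) → Ω → EuclideanSpace ℝ (Fin n))
    (hZ : ∀ x, HasLaw (Z x) (volume.withDensity fun z => ENNReal.ofReal (f x z)) P)
    -- the randomizing density
    (ℓ : EuclideanSpace ℝ (Fin d) → ℝ)
    (hℓ_nonneg : ∀ x, 0 ≤ ℓ x) (hℓ_int : ∫ x, ℓ x = 1) (hℓ_zero : 0 < ℓ 0)
    -- the i.i.d. sample
    (Λ : ℕ → Ω → EuclideanSpace ℝ (Fin d)) (Zs : ℕ → Ω → EuclideanSpace ℝ (Fin n))
    (h_law : ∀ i, HasLaw (fun ω => (Λ i ω, Zs i ω)) (KernelGreeks.randomizedLaw x₀ ℓ f) P)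
    (h_indep : iIndepFun (fun i ω => (Λ i ω, Zs i ω)) P)
    -- the bounded payoff and the kernel
    (φ : EuclideanSpace ℝ (Fin n) → ℝ) (hφ : MemLp φ ⊤ volume)
    (K : EuclideanSpace ℝ (Fin d) → ℝ) (hK : KernelGreeks.AssumptionK K p)
    (hR1 : KernelGreeks.AssumptionR1 p x₀ ℓ f φ)
    -- the bandwidths
    (h : ℕ → ℝ) (h_pos : ∀ N, 0 < h N) (h_zero : Tendsto h atTop (𝓝 0))
    (h_rate : Tendsto (fun N : ℕ => (N : ℝ) * h N ^ (d + 2)) atTop atTop) :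
    let betaN : ℕ → Ω → EuclideanSpace ℝ (Fin d) := fun N ω =>
      KernelGreeks.betaHat K ℓ φ x₀ N (h N) (fun i => Λ i ω) (fun i => Zs i ω)
    let V : EuclideanSpace ℝ (Fin d) → ℝ := fun x => ∫ ω, φ (Z x ω) ∂P
    let β : EuclideanSpace ℝ (Fin d) := gradient V x₀
    let cov : Matrix (Fin d) (Fin d) ℝ :=
      KernelGreeks.asymptoticCov K ℓ (∫ ω, φ (Z x₀ ω) ^ 2 ∂P)
    let rate : ℕ → ℝ := fun N => Real.sqrt ((N : ℝ) * h N ^ (d + 2))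
    ((∀ N, Integrable (betaN N) P) ∧
      TendstoInDistribution (fun N ω => rate N • (betaN N ω - ∫ ω', betaN N ω' ∂P)) atTop id
        (fun _ => P) (multivariateGaussian 0 cov)) ∧
    (KernelGreeks.DominatedOscillation p x₀ ℓ f φ →
      Tendsto (fun N : ℕ => (N : ℝ) * h N ^ (d + 2 + 2 * p)) atTop (𝓝 0) →
      DifferentiableAt ℝ V x₀ ∧
      Tendsto (fun N => (∫ ω, betaN N ω ∂P) - β) atTop (𝓝 0) ∧
      Tendsto (fun N => rate N • ((∫ ω, betaN N ω ∂P) - β)) atTop (𝓝 0) ∧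
      TendstoInDistribution (fun N ω => rate N • (betaN N ω - β)) atTop id
        (fun _ => P) (multivariateGaussian 0 cov)) := by
  intro betaN V β cov rate
  have hp := hK.two_le
  have hfI : ∀ z, KernelGreeks.IterDiff (p + 1) fun x => f x z := hR1.differentiable_f
  have hℓI : KernelGreeks.IterDiff (p + 1) ℓ := hR1.differentiable_ℓ
  have hℓ1 : ContDiff ℝ 1 ℓ := hℓI.contDiff.of_le (by exact_mod_cast (by omega : 1 ≤ p))
  have hf := KernelGreeks.isDensityFamily_of_hasLaw
    (fun z => (KernelGreeks.iterDiff_succ_iff.1 (hfI z)).1.continuous) hf_meas hf_nonneg hZ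
  -- A nonvanishing moment of degree `p ≥ 2` involves at least one coordinate index.
  have hd : d ≠ 0 := by
    obtain ⟨j, _⟩ := hK.order.2.2
    exact Nat.ne_zero_of_lt (j ⟨0, by omega⟩).2
  -- All the laws involved have densities, so the payoff matters only up to Lebesgue null sets and
  -- may be replaced by a measurable version bounded everywhere.
  obtain ⟨ψ, hψ, ⟨M, hM⟩, hφψ⟩ := KernelGreeks.exists_measurable_bounded_ae_eq hφ
  have hV : V = fun x => ∫ z, f x z * ψ z := funext fun x => by
    refine (KernelGreeks.integral_comp_hasLaw (hf_meas x) (hf_nonneg x) (hZ x) hφ.1).trans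
      (integral_congr_ae ?_)
    filter_upwards [hφψ] with z hz
    rw [hz]
  have hm2 : ∫ ω, φ (Z x₀ ω) ^ 2 ∂P = ∫ z, f x₀ z * ψ z ^ 2 := by
    refine (KernelGreeks.integral_comp_hasLaw (φ := fun z => φ z ^ 2) (hf_meas x₀) (hf_nonneg x₀)
      (hZ x₀) (hφ.1.pow 2)).trans (integral_congr_ae ?_)
    filter_upwards [hφψ] with z hz
    rw [hz]
  set betaN' : ℕ → Ω → EuclideanSpace ℝ (Fin d) := fun N ω =>
    KernelGreeks.betaHat K ℓ ψ x₀ N (h N) (fun i => Λ i ω) (fun i => Zs i ω)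
  have hae (N : ℕ) : betaN' N =ᵐ[P] betaN N := by
    have : ∀ᵐ ω ∂P, ∀ i, φ (Zs i ω) = ψ (Zs i ω) :=
      ae_all_iff.2 fun i => KernelGreeks.ae_comp_eq_of_hasLaw_randomizedLaw (h_law i) hφψ
    filter_upwards [this] with ω hω
    simp only [betaN', betaN, KernelGreeks.betaHat, hω]
  have hint (N : ℕ) : ∫ ω, betaN' N ω ∂P = ∫ ω, betaN N ω ∂P := integral_congr_ae (hae N)
  have hI' (N : ℕ) : Integrable (betaN' N) P :=
    KernelGreeks.integrable_betaHat hf hK.contDiff hK.compact hℓ1 hℓ_nonneg hψ hM h_law (h_pos N) N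
  have hclt : TendstoInDistribution (fun N ω => rate N • (betaN N ω - ∫ ω', betaN N ω' ∂P)) atTop id
      (fun _ => P) (multivariateGaussian 0 cov) := by
    have := KernelGreeks.tendstoInDistribution_betaHat_sub_integral hd hf hK.contDiff hK.compact hℓ1
      hℓ_nonneg hℓ_zero hψ hM h_law h_indep h_pos h_zero h_rate
    rw [← hm2] at this
    refine this.congr (fun N => ?_) (ae_eq_refl _)
    filter_upwards [hae N] with ω hω
    change rate N • (betaN' N ω - ∫ ω', betaN' N ω' ∂P) = _
    rw [hω, hint]
  refine ⟨⟨fun N => (hI' N).congr (hae N), hclt⟩, fun hdom hrate => ?_⟩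
  obtain ⟨G, hG, δ, hδ, hosc⟩ := hdom
  obtain ⟨hVd, C, η, hη, hbias⟩ := KernelGreeks.exists_norm_integral_betaHat_sub_gradient_le hf hfI hK
    hℓI hℓ_nonneg hℓ_zero hψ hM hG hδ (by
      -- The domination holds at every `z` for `φ`, but only almost everywhere for `ψ`.
      filter_upwards [hφψ] with z hz i hi x hx
      rw [← hz]
      exact hosc i hi x hx z) h_law
  rw [← hV] at hVd hbias
  have hbias' : ∀ᶠ N in atTop, ‖(∫ ω, betaN N ω ∂P) - β‖ ≤ C * h N ^ p := by
    filter_upwards [h_zero.eventually_lt_const hη, eventually_ne_atTop 0] with N hN hN0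
    rw [← hint]
    exact hbias (h N) (h_pos N) hN N hN0
  have h1 : Tendsto (fun N => (∫ ω, betaN N ω ∂P) - β) atTop (𝓝 0) := by
    refine squeeze_zero_norm' hbias' ?_
    have := (h_zero.pow p).const_mul C
    rwa [zero_pow (by omega), mul_zero] at this
  have h2 : Tendsto (fun N => rate N • ((∫ ω, betaN N ω ∂P) - β)) atTop (𝓝 0) := by
    have h3 : Tendsto (fun N : ℕ => C * Real.sqrt ((N : ℝ) * h N ^ (d + 2 + 2 * p))) atTop (𝓝 0) := by
      have := hrate.sqrt.const_mul C
      rwa [Real.sqrt_zero, mul_zero] at this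
    refine squeeze_zero_norm' ?_ h3
    filter_upwards [hbias'] with N hN
    have hsq : Real.sqrt ((N : ℝ) * h N ^ (d + 2 + 2 * p)) = rate N * h N ^ p := by
      rw [pow_add, ← mul_assoc, Real.sqrt_mul (by have := (h_pos N).le; positivity), mul_comm 2 p,
        pow_mul, Real.sqrt_sq (pow_nonneg (h_pos N).le _)]
    rw [norm_smul, Real.norm_of_nonneg (Real.sqrt_nonneg _), hsq]
    calc _ ≤ rate N * (C * h N ^ p) := mul_le_mul_of_nonneg_left hN (Real.sqrt_nonneg _)
      _ = _ := by ring
  refine ⟨hVd, h1, h2, ?_⟩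
  -- Slutsky's lemma: the rescaled bias is deterministic and tends to zero.
  have h3 := hclt.add_of_tendstoInMeasure_const (c := (0 : EuclideanSpace ℝ (Fin d)))
    (Y := fun N _ => rate N • ((∫ ω, betaN N ω ∂P) - β))
    (tendstoInMeasure_of_tendsto_ae (fun _ => aestronglyMeasurable_const) (ae_of_all _ fun _ => h2))
    fun _ => aemeasurable_const
  refine h3.congr (fun N => ae_of_all _ fun ω => ?_) (ae_of_all _ fun ω => by simp)
  simp only [Pi.add_apply, ← smul_add, sub_add_sub_cancel]
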